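/- Consider a stochastic bandit problem with $K\ge 1$ arms and horizon $T\ge 1$. An environment is a family of probability laws $f_t^k$ on $\mathbb R$ ($1\le t\le T$, $1\le k\le K$); when arm $k$ is selected in slot $t$, a reward with law $f_t^k$ is received, drawn independently of the past. Let $\mu_t^k$ be the mean of $f_t^k$. Fix $b>0$. For $a\in\mathbb R$ and $V_T>0$ let $\mathcal E(V_T,T,K)$ be the set of environments such that, for all $t,k$, $\int e^{\lambda(x-\mu_t^k)}\,f_t^k(dx)\le e^{\lambda^2/8}$ for all $\lambda\in\mathbb R$ and $\mu_t^k\in[a,a+b]$, and such that $\sum_{t=1}^{T-1}\max_k|\mu_{t+1}^k-\mu_t^k|\le V_T$. A policy $\rho$ selects the arm $\varphi_t$, possibly at random, on the basis of the arms selected and the rewards received before slot $t$; its regret in an environment is $$R_T^\rho=\sum_{t=1}^T\max_k\mu_t^k-\mathbb E\Big[\sum_{t=1}^T X_t^{\varphi_t}\Big],$$ where $X_t^{\varphi_t}$ is the reward received in slot $t$. Put $\tau=\lceil K^{1/3}(T/V_T)^{2/3}\rceil$. Resetting MOSS (R-MOSS) cuts the horizon into consecutive epochs of $\tau$ slots (the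 last one possibly shorter) and uses only observations from the current epoch: in each epoch it first selects each arm once, in any order, and then in every slot selects an arm $k$ that maximizes $$\hat\mu_k+\sqrt{\frac{\max\big(\ln(\tau/(K n_k)),0\big)}{n_k}},$$ where $n_k$ and $\hat\mu_k$ are the number of samples and the empirical mean of arm $k$ in the current epoch; ties are broken in any way. Then there are constants $C,c>0$ that depend only on $b$ such that the following holds. 1. For all $a\in\mathbb R$, $K,T\ge 1$ and $V_T>0$ with $\tau\le T$, $$\sup_{\mathcal E(V_T,T,K)}R_T^{\text{R-MOSS}}\le C\,(KV_T)^{1/3}T^{2/3}.$$ 2. This order is optimal: for all $a\in\mathbb R$, $K\ge 2$, $T\ge 1$ and $V_T\in[1/K,T/K]$, $$\inf_\rho\ \sup_{\mathcal E(V_T,T,K)}R_T^\rho\ \ge\ c\,(KV_T)^{1/3}T^{2/3},$$ where the infimum is over all policies. -/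

import Mathlib

open MeasureTheory ProbabilityTheory

namespace Bandit

noncomputable section

/-- An environment with `K` arms: `E t k` is the law of the reward of arm `k` in time slot `t`.
Slots are numbered from `0`; for a horizon `T` only the slots `0, …, T - 1` are ever used. -/
abbrev Environment (K : ℕ) := ℕ → Fin K → ProbabilityMeasure ℝ

/-- The observations (selected arm, received reward) of the slots `0, …, n - 1`. -/
abbrev History (K n : ℕ) := Fin n → Fin K × ℝ

/-- A (possibly randomized) policy: for each slot `n`, the conditional law of the arm selected
in slot `n` given the observations of the earlier slots. -/
structure Policy (K : ℕ) where
  /-- the conditional law of the selected arm -/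
  select : (n : ℕ) → Kernel (History K n) (Fin K)
  /-- it is a probability measure -/
  markov : ∀ n, IsMarkovKernel (select n)

instance {K : ℕ} (ρ : Policy K) (n : ℕ) : IsMarkovKernel (ρ.select n) := ρ.markov n

/-- The mean reward of arm `k` in slot `t`. -/
def mean {K : ℕ} (E : Environment K) (t : ℕ) (k : Fin K) : ℝ :=
  ∫ x, x ∂(E t k : Measure ℝ)

/-- The largest mean reward in slot `t`. -/
def bestMean {K : ℕ} (E : Environment K) (t : ℕ) : ℝ := ⨆ k, mean E t k

/-- The total variation of the mean rewards over the horizon `T`. -/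
def variation {K : ℕ} (E : Environment K) (T : ℕ) : ℝ :=
  ∑ t ∈ Finset.range (T - 1), ⨆ k, |mean E (t + 1) k - mean E t k|

/-- Sub-Gaussian rewards: every centred reward `X` satisfies
`𝔼 exp (l * X) ≤ exp (l ^ 2 / 8)` for all real `l`, and every mean lies in `[a, a + b]`. -/
def IsSubGaussianEnv {K : ℕ} (E : Environment K) (a b : ℝ) (T : ℕ) : Prop :=
  ∀ t < T, ∀ k, HasSubgaussianMGF (fun x => x - mean E t k) (1 / 4) (E t k : Measure ℝ) ∧
    mean E t k ∈ Set.Icc a (a + b)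

/-- The sub-Gaussian environments with total variation at most `V`. -/
def envClass (K : ℕ) (a b : ℝ) (V : ℝ) (T : ℕ) : Set (Environment K) :=
  {E | IsSubGaussianEnv E a b T ∧ variation E T ≤ V}

/-- The law of the reward of slot `t` as a function of the selected arm. -/
def rewardKernel {K : ℕ} (E : Environment K) (t : ℕ) : Kernel (Fin K) ℝ :=
  Kernel.ofFunOfCountable fun k => (E t k : Measure ℝ)

instance {K : ℕ} (E : Environment K) (t : ℕ) : IsMarkovKernel (rewardKernel E t) :=
  ⟨fun k => inferInstanceAs (IsProbabilityMeasure (E t k : Measure ℝ))⟩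

/-- The conditional law of the observation of slot `n` given the earlier ones: the arm is drawn
from the policy, then the reward is drawn from the law of that arm, independently of the past. -/
def stepKernel {K : ℕ} (E : Environment K) (ρ : Policy K) (n : ℕ) :
    Kernel (History K n) (Fin K × ℝ) :=
  ρ.select n ⊗ₖ Kernel.prodMkLeft (History K n) (rewardKernel E n)

instance {K : ℕ} (E : Environment K) (ρ : Policy K) (n : ℕ) :
    IsMarkovKernel (stepKernel E ρ n) := by
  unfold stepKernel; infer_instance

/-- A history extended by one observation. -/
def extend {K n : ℕ} (p : History K n × (Fin K × ℝ)) : History K (n + 1) :=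
  Fin.snoc (α := fun _ => Fin K × ℝ) p.1 p.2

/-- The law of the first `n` observations when policy `ρ` is run in environment `E`. -/
def historyLaw {K : ℕ} (E : Environment K) (ρ : Policy K) : (n : ℕ) → Measure (History K n)
  | 0 => Measure.dirac Fin.elim0
  | n + 1 => (historyLaw E ρ n ⊗ₘ stepKernel E ρ n).map extend

theorem measurable_extend {K n : ℕ} : Measurable (extend (K := K) (n := n)) := by
  refine measurable_pi_lambda _ fun i => ?_
  refine Fin.lastCases ?_ (fun j => ?_) i
  · simpa [extend] using measurable_snd
  · simpa [extend, Function.comp_def] using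
      (measurable_pi_apply (X := fun _ : Fin n => Fin K × ℝ) j).comp
        (measurable_fst (β := Fin K × ℝ))

instance {K : ℕ} (E : Environment K) (ρ : Policy K) (n : ℕ) :
    IsProbabilityMeasure (historyLaw E ρ n) := by
  induction n with
  | zero => unfold historyLaw; infer_instance
  | succ n ih =>
    unfold historyLaw
    exact Measure.isProbabilityMeasure_map measurable_extend.aemeasurable

/-- The regret: the sum of the best means minus the expected cumulative reward. -/
def regret {K : ℕ} (E : Environment K) (ρ : Policy K) (T : ℕ) : ℝ :=
  (∑ t ∈ Finset.range T, bestMean E t) - ∫ h, (∑ s, (h s).2) ∂(historyLaw E ρ T)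

/-- The worst-case regret of a policy over the sub-Gaussian environments within the budget. -/
def worstCaseRegret {K : ℕ} (ρ : Policy K) (a b V : ℝ) (T : ℕ) : EReal :=
  ⨆ E ∈ envClass K a b V T, (regret E ρ T : EReal)

/-- The minimax regret: the infimum of the worst-case regret over all policies. -/
def minimaxRegret (K : ℕ) (a b V : ℝ) (T : ℕ) : EReal :=
  ⨅ ρ : Policy K, worstCaseRegret ρ a b V T

/-- The slots before slot `n` that lie in the epoch of slot `n`, and in which arm `k` was
selected. The epochs are the blocks `{i * τ, …, (i + 1) * τ - 1}`. -/
def epochSamples {K n : ℕ} (τ : ℕ) (h : History K n) (k : Fin K) : Finset (Fin n) :=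
  {s | τ * (n / τ) ≤ (s : ℕ) ∧ (h s).1 = k}

/-- The number of samples of arm `k` since the last restart. -/
def epochCount {K n : ℕ} (τ : ℕ) (h : History K n) (k : Fin K) : ℕ := (epochSamples τ h k).card

/-- The empirical mean of the rewards of arm `k` since the last restart. -/
def epochMean {K n : ℕ} (τ : ℕ) (h : History K n) (k : Fin K) : ℝ :=
  (∑ s ∈ epochSamples τ h k, (h s).2) / epochCount τ h k

/-- The MOSS index of arm `k`, computed from the samples since the last restart, for a run of
MOSS over `τ` slots. -/
def mossIndex {K n : ℕ} (τ : ℕ) (h : History K n) (k : Fin K) : ℝ :=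
  epochMean τ h k +
    √(max (Real.log (τ / (K * epochCount τ h k))) 0 / epochCount τ h k)

/-- MOSS, restarted every `τ` slots, may select arm `k` after history `h`: either `k` has not been
sampled since the last restart, or all arms have been and `k` has the largest index. -/
def IsMossChoice {K n : ℕ} (τ : ℕ) (h : History K n) (k : Fin K) : Prop :=
  epochCount τ h k = 0 ∨
    ((∀ j, epochCount τ h j ≠ 0) ∧ ∀ j, mossIndex τ h j ≤ mossIndex τ h k)

/-- The policy `ρ` is MOSS restarted every `τ` slots. The order of the initial samples and the way
ties are broken, at random or not, are left free. -/
def IsResettingMoss {K : ℕ} (ρ : Policy K) (τ : ℕ) : Prop :=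
  ∀ (n : ℕ) (h : History K n), ∀ᵐ k ∂(ρ.select n h), IsMossChoice τ h k

/-- The restart period `⌈K ^ (1/3) * (T / V) ^ (2/3)⌉`. -/
def restartPeriod (K T : ℕ) (V : ℝ) : ℕ :=
  ⌈(K : ℝ) ^ (1 / 3 : ℝ) * ((T : ℝ) / V) ^ (2 / 3 : ℝ)⌉₊

theorem measurable_epochCount {K n : ℕ} (τ : ℕ) (k : Fin K) :
    Measurable fun h : History K n => epochCount τ h k := by
  simp only [epochCount, epochSamples, Finset.card_filter]
  refine Finset.measurable_sum _ fun s _ => ?_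
  refine Measurable.ite ?_ measurable_const measurable_const
  refine (MeasurableSet.const _).inter ?_
  exact (measurable_fst.comp (measurable_pi_apply s)) (measurableSet_singleton k)

theorem measurable_mossIndex {K n : ℕ} (τ : ℕ) (k : Fin K) :
    Measurable fun h : History K n => mossIndex τ h k := by
  have hc : Measurable fun h : History K n => (epochCount τ h k : ℝ) :=
    (measurable_from_top (f := fun m : ℕ => (m : ℝ))).comp (measurable_epochCount τ k)
  have hs : Measurable fun h : History K n => ∑ s ∈ epochSamples τ h k, (h s).2 := by
    simp only [epochSamples, Finset.sum_filter]
    refine Finset.measurable_sum _ fun s _ => ?_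
    refine Measurable.ite ?_ (measurable_snd.comp (measurable_pi_apply s)) measurable_const
    refine (MeasurableSet.const _).inter ?_
    exact (measurable_fst.comp (measurable_pi_apply s)) (measurableSet_singleton k)
  unfold mossIndex epochMean
  exact (hs.div hc).add
    ((((measurable_const.div (measurable_const.mul hc)).log.max measurable_const).div hc).sqrt)

theorem measurableSet_isMossChoice {K n : ℕ} (τ : ℕ) (k : Fin K) :
    MeasurableSet {h : History K n | IsMossChoice τ h k} := by
  have h0 : ∀ j : Fin K, MeasurableSet {h : History K n | epochCount τ h j = 0} := fun j =>
    measurable_epochCount τ j (measurableSet_singleton 0)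
  have h1 : ∀ j : Fin K, MeasurableSet {h : History K n | mossIndex τ h j ≤ mossIndex τ h k} :=
    fun j => measurableSet_le (measurable_mossIndex τ j) (measurable_mossIndex τ k)
  have : {h : History K n | IsMossChoice τ h k} = {h | epochCount τ h k = 0} ∪
      ((⋂ j, {h | epochCount τ h j = 0}ᶜ) ∩ ⋂ j, {h | mossIndex τ h j ≤ mossIndex τ h k}) := by
    ext h; simp [IsMossChoice]
  rw [this]
  exact (h0 k).union ((MeasurableSet.iInter fun j => (h0 j).compl).inter (MeasurableSet.iInter h1))

theorem exists_isMossChoice {K n : ℕ} (hK : 0 < K) (τ : ℕ) (h : History K n) :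
    ∃ k, IsMossChoice τ h k := by
  by_cases hj : ∃ j, epochCount τ h j = 0
  · exact hj.imp fun _ hk => Or.inl hk
  · have : Nonempty (Fin K) := ⟨⟨0, hK⟩⟩
    obtain ⟨k, hk⟩ := Finite.exists_max fun j => mossIndex τ h j
    exact ⟨k, Or.inr ⟨fun j hj' => hj ⟨j, hj'⟩, hk⟩⟩

/-- Resetting MOSS exists as a policy, for instance with ties broken by the smallest index. -/
theorem exists_isResettingMoss {K : ℕ} (hK : 0 < K) (τ : ℕ) :
    ∃ ρ : Policy K, IsResettingMoss ρ τ := by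
  classical
  let φ : (n : ℕ) → History K n → Fin K := fun n h => Fin.find _ (exists_isMossChoice hK τ h)
  have hφ : ∀ n, Measurable (φ n) := fun n => by
    refine measurable_to_countable' fun k => ?_
    have : φ n ⁻¹' {k} = {h | IsMossChoice τ h k} ∩
        ⋂ j, ⋂ (_ : j < k), {h | IsMossChoice τ h j}ᶜ := by
      ext h
      simp [φ, Fin.find_eq_iff]
    rw [this]
    exact (measurableSet_isMossChoice τ k).inter (MeasurableSet.iInter fun j =>
      MeasurableSet.iInter fun _ => (measurableSet_isMossChoice τ j).compl)
  refine ⟨⟨fun n => Kernel.deterministic (φ n) (hφ n), fun n => inferInstance⟩, fun n h => ?_⟩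
  simp only [Kernel.deterministic_apply]
  rw [ae_dirac_eq]
  exact Fin.find_spec (exists_isMossChoice hK τ h)

end

end Bandit

namespace Bandit

open scoped ENNReal

/-! ### The law of a history -/

section HistoryLaw

variable {K : ℕ} {E E' : Environment K} {ρ : Policy K}

/-! Upper bound. Let `A = τ / K`, and let `j` be the best arm at the start of an epoch. On every
path that MOSS can produce, a slot that selects an arm `k` already sampled in the epoch costs at
most four times the drift within the epoch, plus `1 / √A`, plus the amount by which the index of `j`
can fall short of its mean, plus the bonus of `k` and the amount by which the empirical mean of `k`
overshoots (`gap_le_of_mossIndex_le`). The shortfall concerns the single arm `j`, so it may be paid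
in each of the `τ` slots: its expectation is of order `1 / √A`. The last two terms are summed over
the samples of each arm and give order `√A` per arm. Since `τ / √A = K √A = √(K τ)`, an epoch costs
order `√(K τ)` plus `τ` times its drift (`epoch_regret_le`).

The deviations are controlled uniformly in time. If `D` is the logarithm of an exponential
supermartingale and `L` its running maximum above a floor `κ`, then `L + exp (D - L)` is again a
supermartingale, so the expected excess of `L` over `κ` is at most `exp (-κ)`
(`integral_runMax_sub_le`). This is applied once for each dyadic range of sample sizes, and the
resulting bounds have a finite sum over the scales.

Adding the epochs gives order `T √(K / τ) + τ V`. The unrounded period `x` makes both terms equal to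
the rate: `T √(K / x) = x V = (K V)^(1/3) T^(2/3)`.

Lower bound. Rewards are two-valued and, in each batch of about `x` slots, one arm is better by `ε`,
of order `√(K / x)`. Against the baseline without a better arm, raising one arm changes the law of
the history by a relative entropy of at most `4 ε²` times the expected number of its selections.
Averaging over the arms shows that some arm, once raised, still receives at most three quarters of
the batch (`exists_hard_arm`). Since the policy is known to the adversary and earlier selections do
not depend on later rewards, such arms can be fixed batch by batch (`exists_hard_sequence`). The
regret is then at least `ε T / 4`, and the variation at most `ε` per change of batch. -/

theorem lintegral_stepKernel {n : ℕ} (h : History K n) {f : Fin K × ℝ → ℝ≥0∞}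
    (hf : Measurable f) :
    ∫⁻ o, f o ∂(stepKernel E ρ n h) =
      ∫⁻ k, ∫⁻ x, f (k, x) ∂(E n k : Measure ℝ) ∂(ρ.select n h) := by
  rw [stepKernel, Kernel.lintegral_compProd _ _ _ hf]
  rfl

theorem lintegral_historyLaw_succ {n : ℕ} {f : History K (n + 1) → ℝ≥0∞} (hf : Measurable f) :
    ∫⁻ h, f h ∂(historyLaw E ρ (n + 1)) =
      ∫⁻ h, ∫⁻ o, f (extend (h, o)) ∂(stepKernel E ρ n h) ∂(historyLaw E ρ n) := by
  rw [historyLaw, lintegral_map hf measurable_extend,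
    Measure.lintegral_compProd (f := fun p => f (extend p)) (hf.comp measurable_extend)]

/-- Causality. It lets the lower bound choose the best arm of a later batch without disturbing the
earlier ones. -/
theorem historyLaw_congr {n : ℕ} (hE : ∀ t < n, E t = E' t) :
    historyLaw E ρ n = historyLaw E' ρ n := by
  induction n with
  | zero => rfl
  | succ n ih =>
    have hs : stepKernel E ρ n = stepKernel E' ρ n := by
      simp only [stepKernel, rewardKernel, hE n n.lt_succ_self]
    simp only [historyLaw, ih fun t ht => hE t (ht.trans n.lt_succ_self), hs]

theorem measurable_init {n : ℕ} :
    Measurable fun h : History K (n + 1) => (Fin.init h : History K n) :=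
  measurable_pi_lambda _ fun i => measurable_pi_apply i.castSucc

@[simp]
theorem init_extend {n : ℕ} (h : History K n) (o : Fin K × ℝ) :
    (Fin.init (extend (h, o)) : History K n) = h :=
  Fin.init_snoc (α := fun _ => Fin K × ℝ) o h

@[simp]
theorem extend_last {n : ℕ} (h : History K n) (o : Fin K × ℝ) :
    extend (h, o) (Fin.last n) = o :=
  Fin.snoc_last (α := fun _ => Fin K × ℝ) o h

@[simp]
theorem extend_castSucc {n : ℕ} (h : History K n) (o : Fin K × ℝ) (s : Fin n) :
    extend (h, o) s.castSucc = h s :=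
  Fin.snoc_castSucc (α := fun _ => Fin K × ℝ) o h s

theorem extend_init {n : ℕ} (h : History K (n + 1)) :
    extend ((Fin.init h : History K n), h (Fin.last n)) = h :=
  Fin.snoc_init_self h

/-- The first `n` observations of a run of `n + 1` slots are a run of `n` slots. -/
theorem map_init_historyLaw (n : ℕ) :
    (historyLaw E ρ (n + 1)).map (fun h => (Fin.init h : History K n)) = historyLaw E ρ n := by
  refine Measure.ext_of_lintegral _ fun f hf => ?_
  rw [lintegral_map hf measurable_init, lintegral_historyLaw_succ
    (f := fun h => f (Fin.init h : History K n)) (hf.comp measurable_init)]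
  simp

/-- The probability that policy `ρ` selects arm `k` in slot `n`, as an extended number. -/
noncomputable def armMass (E : Environment K) (ρ : Policy K) (n : ℕ) (k : Fin K) : ℝ≥0∞ :=
  ∫⁻ h, ρ.select n h {k} ∂(historyLaw E ρ n)

/-- The probability that policy `ρ` selects arm `k` in slot `n`. -/
noncomputable def armProb (E : Environment K) (ρ : Policy K) (n : ℕ) (k : Fin K) : ℝ :=
  (armMass E ρ n k).toReal

theorem sum_armMass (n : ℕ) : ∑ k, armMass E ρ n k = 1 := by
  simp only [armMass]
  rw [← lintegral_finsetSum _ fun k _ => Kernel.measurable_coe _ (measurableSet_singleton k)]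
  simp

theorem armMass_ne_top (n : ℕ) (k : Fin K) : armMass E ρ n k ≠ ∞ := by
  have h : armMass E ρ n k ≤ ∑ j, armMass E ρ n j :=
    Finset.single_le_sum (fun _ _ => zero_le) (Finset.mem_univ k)
  rw [sum_armMass] at h
  exact (h.trans_lt ENNReal.one_lt_top).ne

theorem armProb_nonneg (n : ℕ) (k : Fin K) : 0 ≤ armProb E ρ n k := ENNReal.toReal_nonneg

theorem sum_armProb (n : ℕ) : ∑ k, armProb E ρ n k = 1 := by
  simp only [armProb]
  rw [← ENNReal.toReal_sum fun k _ => armMass_ne_top n k, sum_armMass, ENNReal.toReal_one]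

theorem armProb_congr {n : ℕ} (hE : ∀ t < n, E t = E' t) (k : Fin K) :
    armProb E ρ n k = armProb E' ρ n k := by
  simp only [armProb, armMass, historyLaw_congr hE]

/-- The law of the observation of slot `n` is a mixture over the arms. -/
theorem map_last_historyLaw (n : ℕ) :
    (historyLaw E ρ (n + 1)).map (fun h => h (Fin.last n)) =
      ∑ k, armMass E ρ n k • (E n k : Measure ℝ).map (Prod.mk k) := by
  refine Measure.ext_of_lintegral _ fun f hf => ?_
  rw [lintegral_map hf (measurable_pi_apply _),
    lintegral_historyLaw_succ (f := fun h => f (h (Fin.last n)))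
      (hf.comp (measurable_pi_apply _)), lintegral_finsetSum_measure]
  simp only [extend_last, lintegral_stepKernel _ hf, lintegral_smul_measure, smul_eq_mul]
  simp only [lintegral_fintype]
  rw [lintegral_finsetSum _ fun k _ =>
    (Kernel.measurable_coe _ (measurableSet_singleton k)).const_mul _]
  refine Finset.sum_congr rfl fun k _ => ?_
  rw [lintegral_const_mul _ (Kernel.measurable_coe _ (measurableSet_singleton k)),
    lintegral_map hf measurable_prodMk_left, armMass, mul_comm]

theorem integrable_last_historyLaw {n : ℕ} {f : Fin K × ℝ → ℝ} (hf : Measurable f)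
    (hi : ∀ k, Integrable (fun x => f (k, x)) (E n k : Measure ℝ)) :
    Integrable (fun h => f (h (Fin.last n))) (historyLaw E ρ (n + 1)) := by
  have : Integrable f ((historyLaw E ρ (n + 1)).map fun h => h (Fin.last n)) := by
    rw [map_last_historyLaw, integrable_finsetSum_measure]
    intro k _
    refine Integrable.smul_measure ?_ (armMass_ne_top n k)
    exact (integrable_map_measure hf.aestronglyMeasurable
      measurable_prodMk_left.aemeasurable).2 (hi k)
  exact (integrable_map_measure hf.aestronglyMeasurable
    (measurable_pi_apply (Fin.last n)).aemeasurable).1 this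

theorem integral_last_historyLaw {n : ℕ} {f : Fin K × ℝ → ℝ} (hf : Measurable f)
    (hi : ∀ k, Integrable (fun x => f (k, x)) (E n k : Measure ℝ)) :
    ∫ h, f (h (Fin.last n)) ∂(historyLaw E ρ (n + 1)) =
      ∑ k, armProb E ρ n k * ∫ x, f (k, x) ∂(E n k : Measure ℝ) := by
  rw [← integral_map (φ := fun h : History K (n + 1) => h (Fin.last n))
    (measurable_pi_apply _).aemeasurable hf.aestronglyMeasurable, map_last_historyLaw,
    integral_finsetSum_measure]
  · refine Finset.sum_congr rfl fun k _ => ?_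
    rw [integral_smul_measure, integral_map measurable_prodMk_left.aemeasurable
      hf.aestronglyMeasurable]
    rfl
  · intro k _
    refine Integrable.smul_measure ?_ (armMass_ne_top n k)
    exact (integrable_map_measure hf.aestronglyMeasurable
      measurable_prodMk_left.aemeasurable).2 (hi k)

/-- The additive functional `∑ s, F s (h s)` of a history. -/
noncomputable def cumul (F : ℕ → Fin K × ℝ → ℝ) {n : ℕ} (h : History K n) : ℝ :=
  ∑ s : Fin n, F s (h s)

@[simp]
theorem cumul_extend (F : ℕ → Fin K × ℝ → ℝ) {n : ℕ} (h : History K n) (o : Fin K × ℝ) :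
    cumul F (extend (h, o)) = cumul F h + F n o := by
  simp [cumul, Fin.sum_univ_castSucc]

@[simp]
theorem cumul_zero (F : ℕ → Fin K × ℝ → ℝ) (h : History K 0) : cumul F h = 0 := by
  simp [cumul]

theorem cumul_succ (F : ℕ → Fin K × ℝ → ℝ) {n : ℕ} (h : History K (n + 1)) :
    cumul F h = cumul F (Fin.init h : History K n) + F n (h (Fin.last n)) := by
  conv_lhs => rw [← extend_init h]
  rw [cumul_extend]

theorem measurable_cumul {F : ℕ → Fin K × ℝ → ℝ} (hF : ∀ t, Measurable (F t)) (n : ℕ) :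
    Measurable fun h : History K n => cumul F h :=
  Finset.measurable_sum _ fun s _ => (hF s).comp (measurable_pi_apply s)

/-- By linearity only the marginal law of each slot matters, and this is a mixture of the arm laws
with weights `armProb`. Regret, sample counts and relative entropy are all evaluated this way. -/
theorem integrable_cumul {F : ℕ → Fin K × ℝ → ℝ} (hF : ∀ t, Measurable (F t)) {n : ℕ}
    (hi : ∀ t < n, ∀ k, Integrable (fun x => F t (k, x)) (E t k : Measure ℝ)) :
    Integrable (fun h : History K n => cumul F h) (historyLaw E ρ n) ∧
    ∫ h, cumul F h ∂(historyLaw E ρ n) =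
      ∑ t ∈ Finset.range n, ∑ k, armProb E ρ t k * ∫ x, F t (k, x) ∂(E t k : Measure ℝ) := by
  induction n with
  | zero => simp
  | succ n ih =>
    obtain ⟨ih1, ih2⟩ := ih fun t ht => hi t (ht.trans n.lt_succ_self)
    have hm := (measurable_cumul hF n).aestronglyMeasurable (μ := historyLaw E ρ n)
    rw [← map_init_historyLaw] at ih1 ih2 hm
    rw [integral_map measurable_init.aemeasurable hm] at ih2
    have i1 : Integrable (fun h : History K (n + 1) => cumul F (Fin.init h : History K n))
      (historyLaw E ρ (n + 1)) := (integrable_map_measure hm measurable_init.aemeasurable).1 ih1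
    have i2 := integrable_last_historyLaw (ρ := ρ) (hF n) (hi n n.lt_succ_self)
    simp only [cumul_succ]
    refine ⟨i1.add i2, ?_⟩
    rw [integral_add i1 i2, ih2, integral_last_historyLaw (hF n) (hi n n.lt_succ_self),
      Finset.sum_range_succ]

end HistoryLaw

/-! ### Regret as an expected cumulative gap -/

section Regret

variable {K : ℕ} {E : Environment K} {ρ : Policy K}

theorem mean_le_bestMean (t : ℕ) (k : Fin K) : mean E t k ≤ bestMean E t :=
  le_ciSup (Set.finite_range fun k => mean E t k).bddAbove k

theorem IsSubGaussianEnv.integrable_id {a b : ℝ} {T : ℕ} (hE : IsSubGaussianEnv E a b T) {t : ℕ}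
    (ht : t < T) (k : Fin K) : Integrable (fun x => x) (E t k : Measure ℝ) := by
  have := (hE t ht k).1.integrable.add (integrable_const (mean E t k))
  simpa [Pi.add_def] using this

/-- The regret is the expected cumulative gap between the best mean and the selected mean. -/
theorem regret_eq_sum {a b : ℝ} {T : ℕ} (hE : IsSubGaussianEnv E a b T) :
    regret E ρ T =
      ∑ t ∈ Finset.range T, ∑ k, armProb E ρ t k * (bestMean E t - mean E t k) := by
  have h := (integrable_cumul (E := E) (ρ := ρ) (F := fun _ o => o.2) (n := T)
    (fun _ => measurable_snd) fun t ht k => hE.integrable_id ht k).2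
  simp only [cumul] at h
  rw [regret, h, ← Finset.sum_sub_distrib]
  refine Finset.sum_congr rfl fun t _ => ?_
  simp only [mul_sub, Finset.sum_sub_distrib, ← Finset.sum_mul, sum_armProb, one_mul, mean]

/-- The gap of the selected arm in the slots from `s₀` on. -/
noncomputable def gapFrom (E : Environment K) (s₀ : ℕ) (t : ℕ) (o : Fin K × ℝ) : ℝ :=
  if s₀ ≤ t then bestMean E t - mean E t o.1 else 0

theorem measurable_gapFrom (s₀ t : ℕ) : Measurable (gapFrom E s₀ t) := by
  unfold gapFrom
  split_ifs
  · exact measurable_const.sub ((measurable_of_finite fun k => mean E t k).comp measurable_fst)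
  · exact measurable_const

theorem integral_cumul_gapFrom (s₀ n : ℕ) :
    Integrable (fun h : History K n => cumul (gapFrom E s₀) h) (historyLaw E ρ n) ∧
    ∫ h, cumul (gapFrom E s₀) h ∂(historyLaw E ρ n) =
      ∑ t ∈ Finset.Ico s₀ n, ∑ k, armProb E ρ t k * (bestMean E t - mean E t k) := by
  obtain ⟨h1, h2⟩ := integrable_cumul (E := E) (ρ := ρ) (n := n)
    (measurable_gapFrom (E := E) s₀) fun t _ k => by
      simp only [gapFrom]; exact integrable_const _
  refine ⟨h1, h2.trans ?_⟩
  have : Finset.Ico s₀ n = (Finset.range n).filter (s₀ ≤ ·) := by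
    ext t; simp [and_comm]
  rw [this, Finset.sum_filter]
  refine Finset.sum_congr rfl fun t _ => ?_
  by_cases ht : s₀ ≤ t <;> simp [gapFrom, ht]

end Regret

/-! ### The running maximum of an exponential supermartingale -/

section RunMax

variable {K : ℕ} {E : Environment K} {ρ : Policy K}

/-- The maximum of `κ` and of the values of the functional `cumul F` along a history. -/
noncomputable def runMax (F : ℕ → Fin K × ℝ → ℝ) (κ : ℝ) : {n : ℕ} → History K n → ℝ
  | 0, _ => max κ 0
  | n + 1, h => max (runMax F κ (Fin.init h : History K n)) (cumul F h)

@[simp]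
theorem runMax_extend (F : ℕ → Fin K × ℝ → ℝ) (κ : ℝ) {n : ℕ} (h : History K n) (o : Fin K × ℝ) :
    runMax F κ (extend (h, o)) = max (runMax F κ h) (cumul F h + F n o) := by
  simp [runMax]

theorem runMax_le_extend (F : ℕ → Fin K × ℝ → ℝ) (κ : ℝ) {n : ℕ} (h : History K n)
    (o : Fin K × ℝ) : runMax F κ h ≤ runMax F κ (extend (h, o)) := by
  simp

theorem le_runMax (F : ℕ → Fin K × ℝ → ℝ) (κ : ℝ) {n : ℕ} (h : History K n) :
    κ ≤ runMax F κ h := by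
  induction n with
  | zero => exact le_max_left _ _
  | succ n ih => exact (ih _).trans (le_max_left _ _)

theorem cumul_le_runMax (F : ℕ → Fin K × ℝ → ℝ) (κ : ℝ) {n : ℕ} (h : History K n) :
    cumul F h ≤ runMax F κ h := by
  cases n with
  | zero => simp [runMax]
  | succ n => exact le_max_right _ _

theorem measurable_runMax {F : ℕ → Fin K × ℝ → ℝ} (hF : ∀ t, Measurable (F t)) (κ : ℝ) (n : ℕ) :
    Measurable fun h : History K n => runMax F κ h := by
  induction n with
  | zero => exact measurable_const
  | succ n ih => exact (ih.comp measurable_init).max (measurable_cumul hF (n + 1))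

/-- When `D` sets a new record, the increase `D - L` is paid for by the drop of the exponential from
`exp (D - L)` to `1`. This is the only inequality behind the maximal inequality. -/
theorem max_add_exp_sub_max_le (L D : ℝ) :
    max L D + Real.exp (D - max L D) ≤ L + Real.exp (D - L) := by
  rcases le_total L D with h | h
  · rw [max_eq_right h, sub_self, Real.exp_zero]
    linarith [Real.add_one_le_exp (D - L)]
  · rw [max_eq_left h]

/-- With `L` the running maximum and `D` the functional, one more slot turns `L + exp (D - L)` into
at most `L + exp (D - L) * exp (F n o)`, whose conditional mean is no larger than before. Induction
goes back to the empty history. -/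
theorem lintegral_runMax_add_le {F : ℕ → Fin K × ℝ → ℝ} (hF : ∀ t, Measurable (F t)) {n : ℕ}
    (hmgf : ∀ t < n, ∀ k,
      ∫⁻ x, ENNReal.ofReal (Real.exp (F t (k, x))) ∂(E t k : Measure ℝ) ≤ 1) (κ : ℝ) :
    ∫⁻ h : History K n, ENNReal.ofReal
      ((runMax F κ h - κ) + Real.exp (cumul F h - runMax F κ h)) ∂(historyLaw E ρ n) ≤
      ENNReal.ofReal (Real.exp (-κ)) := by
  induction n with
  | zero =>
    simp only [cumul_zero, runMax, lintegral_const, measure_univ, mul_one]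
    refine ENNReal.ofReal_le_ofReal ?_
    have := max_add_exp_sub_max_le κ 0
    rw [zero_sub] at this ⊢
    rw [zero_sub] at this
    linarith
  | succ n ih =>
    refine le_trans ?_ (ih fun t ht => hmgf t (ht.trans n.lt_succ_self))
    have hm := (measurable_runMax hF κ (n + 1))
    have hmeas : Measurable fun h : History K (n + 1) => ENNReal.ofReal
        ((runMax F κ h - κ) + Real.exp (cumul F h - runMax F κ h)) :=
      ((hm.sub_const κ).add ((measurable_cumul hF (n + 1)).sub hm).exp).ennreal_ofReal
    rw [lintegral_historyLaw_succ hmeas]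
    refine lintegral_mono fun h => ?_
    set L := runMax F κ h with hL
    set D := cumul F h with hD
    have hL0 : 0 ≤ L - κ := sub_nonneg.2 (le_runMax F κ h)
    have key : ∀ o, ENNReal.ofReal ((runMax F κ (extend (h, o)) - κ) +
        Real.exp (cumul F (extend (h, o)) - runMax F κ (extend (h, o)))) ≤
        ENNReal.ofReal (L - κ) +
          ENNReal.ofReal (Real.exp (D - L)) * ENNReal.ofReal (Real.exp (F n o)) := by
      intro o
      rw [← ENNReal.ofReal_mul (Real.exp_nonneg _), ← Real.exp_add,
        ← ENNReal.ofReal_add hL0 (Real.exp_nonneg _)]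
      refine ENNReal.ofReal_le_ofReal ?_
      simp only [runMax_extend, cumul_extend]
      have := max_add_exp_sub_max_le L (D + F n o)
      rw [show D - L + F n o = D + F n o - L by ring]
      linarith
    have hmF : Measurable fun o => ENNReal.ofReal (Real.exp (F n o)) := (hF n).exp.ennreal_ofReal
    calc _ ≤ ∫⁻ o, (ENNReal.ofReal (L - κ) + ENNReal.ofReal (Real.exp (D - L)) *
            ENNReal.ofReal (Real.exp (F n o))) ∂(stepKernel E ρ n h) := lintegral_mono key
      _ = ENNReal.ofReal (L - κ) + ENNReal.ofReal (Real.exp (D - L)) *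
            ∫⁻ o, ENNReal.ofReal (Real.exp (F n o)) ∂(stepKernel E ρ n h) := by
          rw [lintegral_add_left measurable_const, lintegral_const_mul _ hmF, lintegral_const,
            measure_univ, mul_one]
      _ ≤ ENNReal.ofReal (L - κ) + ENNReal.ofReal (Real.exp (D - L)) * 1 := by
          gcongr
          rw [lintegral_stepKernel h hmF]
          calc _ ≤ ∫⁻ _, 1 ∂(ρ.select n h) := lintegral_mono fun k => hmgf n n.lt_succ_self k
            _ = 1 := by simp
      _ = _ := by rw [mul_one, ← ENNReal.ofReal_add hL0 (Real.exp_nonneg _)]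

/-- A maximal inequality: if the increments of `cumul F` have exponential moment at most `1`,
then the expected excess of its running maximum over the level `κ` is at most `exp (-κ)`. -/
theorem integral_runMax_sub_le {F : ℕ → Fin K × ℝ → ℝ} (hF : ∀ t, Measurable (F t)) {n : ℕ}
    (hmgf : ∀ t < n, ∀ k,
      ∫⁻ x, ENNReal.ofReal (Real.exp (F t (k, x))) ∂(E t k : Measure ℝ) ≤ 1) (κ : ℝ) :
    Integrable (fun h : History K n => runMax F κ h - κ) (historyLaw E ρ n) ∧
      ∫ h : History K n, (runMax F κ h - κ) ∂(historyLaw E ρ n) ≤ Real.exp (-κ) := by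
  have hm := ((measurable_runMax hF κ n).sub_const κ).aestronglyMeasurable
    (μ := historyLaw E ρ n)
  have h0 : ∀ h : History K n, 0 ≤ runMax F κ h - κ := fun h => sub_nonneg.2 (le_runMax F κ h)
  have hle : ∫⁻ h : History K n, ENNReal.ofReal (runMax F κ h - κ) ∂(historyLaw E ρ n) ≤
      ENNReal.ofReal (Real.exp (-κ)) := by
    refine le_trans (lintegral_mono fun h => ENNReal.ofReal_le_ofReal ?_)
      (lintegral_runMax_add_le hF hmgf κ)
    exact le_add_of_nonneg_right (Real.exp_nonneg _)
  refine ⟨⟨hm, ?_⟩, ?_⟩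
  · rw [hasFiniteIntegral_iff_ofReal (ae_of_all _ h0)]
    exact hle.trans_lt ENNReal.ofReal_lt_top
  · rw [integral_eq_lintegral_of_nonneg_ae (ae_of_all _ h0) hm]
    exact ENNReal.toReal_le_of_le_ofReal (Real.exp_nonneg _) hle

end RunMax

/-! ### Deviations of the sample sums of one arm -/

section Deviation

variable {K : ℕ} {E : Environment K} {ρ : Policy K}

/-- The number of selections of arm `k` from slot `s₀` on. -/
def countFrom (s₀ : ℕ) (k : Fin K) {n : ℕ} (h : History K n) : ℕ :=
  ∑ s : Fin n, if s₀ ≤ (s : ℕ) ∧ (h s).1 = k then 1 else 0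

@[simp]
theorem countFrom_extend (s₀ : ℕ) (k : Fin K) {n : ℕ} (h : History K n) (o : Fin K × ℝ) :
    countFrom s₀ k (extend (h, o)) =
      countFrom s₀ k h + if s₀ ≤ n ∧ o.1 = k then 1 else 0 := by
  simp only [countFrom]
  rw [Fin.sum_univ_castSucc]
  simp only [extend_castSucc, extend_last, Fin.val_castSucc, Fin.val_last]

theorem countFrom_of_le {s₀ n : ℕ} (hn : n ≤ s₀) (k : Fin K) (h : History K n) :
    countFrom s₀ k h = 0 := by
  refine Finset.sum_eq_zero fun s _ => if_neg fun hs => ?_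
  have := s.2
  omega

theorem countFrom_le (s₀ n : ℕ) (k : Fin K) (h : History K n) : countFrom s₀ k h ≤ n - s₀ := by
  induction n with
  | zero => simp [countFrom]
  | succ n ih =>
    rw [← extend_init h, countFrom_extend]
    have := ih (Fin.init h)
    split_ifs <;> omega

/-- The centred reward of arm `k` in the slots from `s₀` on. -/
noncomputable def noise (E : Environment K) (s₀ : ℕ) (k : Fin K) (t : ℕ) (o : Fin K × ℝ) : ℝ :=
  if s₀ ≤ t ∧ o.1 = k then o.2 - mean E t k else 0

/-- The increments of the logarithm of the exponential supermartingale of arm `k`. -/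
noncomputable def tilt (E : Environment K) (s₀ : ℕ) (k : Fin K) (l : ℝ) (t : ℕ)
    (o : Fin K × ℝ) : ℝ :=
  if s₀ ≤ t ∧ o.1 = k then l * (o.2 - mean E t k) - l ^ 2 / 8 else 0

theorem measurable_tilt (s₀ : ℕ) (k : Fin K) (l : ℝ) (t : ℕ) : Measurable (tilt E s₀ k l t) := by
  refine Measurable.ite ?_ (((measurable_snd.sub_const _).const_mul l).sub_const _)
    measurable_const
  exact (MeasurableSet.const _).inter (measurable_fst (measurableSet_singleton k))

theorem cumul_tilt (s₀ : ℕ) (k : Fin K) (l : ℝ) {n : ℕ} (h : History K n) :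
    cumul (tilt E s₀ k l) h = l * cumul (noise E s₀ k) h - l ^ 2 / 8 * countFrom s₀ k h := by
  simp only [cumul, countFrom, Nat.cast_sum, Finset.mul_sum, ← Finset.sum_sub_distrib]
  refine Finset.sum_congr rfl fun s _ => ?_
  simp only [tilt, noise]
  split_ifs <;> simp

/-- The compensator `l ^ 2 / 8` in `tilt` is the sub-Gaussian exponent for variance proxy `1 / 4`.
Slots before `s₀` and other arms contribute the factor `1`. -/
theorem lintegral_exp_tilt_le {a b : ℝ} {T : ℕ} (hE : IsSubGaussianEnv E a b T) (s₀ : ℕ)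
    (k : Fin K) (l : ℝ) {t : ℕ} (ht : t < T) (j : Fin K) :
    ∫⁻ x, ENNReal.ofReal (Real.exp (tilt E s₀ k l t (j, x))) ∂(E t j : Measure ℝ) ≤ 1 := by
  by_cases hj : s₀ ≤ t ∧ j = k
  · obtain ⟨hs, rfl⟩ := hj
    have hg := (hE t ht j).1
    have hmgf := hg.mgf_le l
    have hi := hg.integrable_exp_mul l
    simp only [tilt, hs, true_and, if_true, Real.exp_sub]
    rw [← ofReal_integral_eq_lintegral_ofReal (hi.div_const _)
      (ae_of_all _ fun x => by positivity), integral_div, ← ENNReal.ofReal_one]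
    refine ENNReal.ofReal_le_ofReal ((div_le_one (Real.exp_pos _)).2 (hmgf.trans_eq ?_))
    congr 1
    push_cast
    ring
  · simp [tilt, hj]

/-- An upper bound for the excess of `σ` times the noise sum of arm `k` over `m * θ`, as long as
arm `k` has at most `2 * m` samples. -/
noncomputable def excess (E : Environment K) (s₀ : ℕ) (k : Fin K) (σ m θ : ℝ) {n : ℕ}
    (h : History K n) : ℝ :=
  (runMax (tilt E s₀ k (σ * (2 * θ + 2 / √m))) (m * θ ^ 2 - 1) h - (m * θ ^ 2 - 1)) /
    (2 * θ + 2 / √m)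

theorem excess_nonneg (s₀ : ℕ) (k : Fin K) (σ m : ℝ) {θ : ℝ} (hθ : 0 ≤ θ) {n : ℕ}
    (h : History K n) : 0 ≤ excess E s₀ k σ m θ h :=
  div_nonneg (sub_nonneg.2 (le_runMax _ _ h)) (by positivity)

theorem excess_le_extend (s₀ : ℕ) (k : Fin K) (σ m : ℝ) {θ : ℝ} (hθ : 0 ≤ θ) {n : ℕ}
    (h : History K n) (o : Fin K × ℝ) :
    excess E s₀ k σ m θ h ≤ excess E s₀ k σ m θ (extend (h, o)) :=
  div_le_div_of_nonneg_right (sub_le_sub_right (runMax_le_extend _ _ h o) _) (by positivity)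

/-- The current value of the supermartingale is below its running maximum; solving for the noise
sum, with the compensator bounded through the count, gives the claim. The sign `σ` selects the tail.
-/
theorem mul_cumul_noise_le (s₀ : ℕ) (k : Fin K) {σ m θ : ℝ} (hσ : σ ^ 2 = 1) (hm : 0 < m)
    (hθ : 0 ≤ θ) {n : ℕ} (h : History K n) (hc : (countFrom s₀ k h : ℝ) ≤ 2 * m) :
    σ * cumul (noise E s₀ k) h ≤ m * θ + excess E s₀ k σ m θ h := by
  have hr := cumul_le_runMax (tilt E s₀ k (σ * (2 * θ + 2 / √m))) (m * θ ^ 2 - 1) h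
  rw [cumul_tilt] at hr
  have hs : 0 < √m := Real.sqrt_pos.2 hm
  set l := 2 * θ + 2 / √m with hl
  have hl0 : 0 < l := by positivity
  have hU : runMax (tilt E s₀ k (σ * l)) (m * θ ^ 2 - 1) h =
      (m * θ ^ 2 - 1) + l * excess E s₀ k σ m θ h := by
    rw [excess, ← hl]; field_simp; ring
  rw [hU, mul_pow, hσ, one_mul] at hr
  have h1 : l ^ 2 / 8 * (countFrom s₀ k h : ℝ) ≤ l ^ 2 / 8 * (2 * m) := by gcongr
  -- The tilt `2 θ + 2 / √m` and the floor `m θ² - 1` are chosen to make this an identity. The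
  -- summand `2 / √m` also keeps the tilt away from zero when `θ = 0`.
  have h2 : l ^ 2 / 8 * (2 * m) + (m * θ ^ 2 - 1) = l * (m * θ) := by
    have : (√m) ^ 2 = m := Real.sq_sqrt hm.le
    rw [hl]
    generalize √m = r at hs this
    subst this
    field_simp
    ring
  have h3 : l * (σ * cumul (noise E s₀ k) h) ≤ l * (m * θ + excess E s₀ k σ m θ h) := by
    linarith
  exact le_of_mul_le_mul_left h3 hl0

theorem integral_excess_le {a b : ℝ} {T : ℕ} (hE : IsSubGaussianEnv E a b T) (s₀ : ℕ)
    (k : Fin K) (σ : ℝ) {m θ : ℝ} (hm : 0 < m) (hθ : 0 ≤ θ) {n : ℕ} (hn : n ≤ T) :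
    Integrable (fun h : History K n => excess E s₀ k σ m θ h) (historyLaw E ρ n) ∧
    ∫ h : History K n, excess E s₀ k σ m θ h ∂(historyLaw E ρ n) ≤
      3 / 2 * (√m * Real.exp (-(m * θ ^ 2))) := by
  obtain ⟨h1, h2⟩ := integral_runMax_sub_le (E := E) (ρ := ρ) (n := n)
    (measurable_tilt (E := E) s₀ k (σ * (2 * θ + 2 / √m)))
    (fun t ht j => lintegral_exp_tilt_le hE s₀ k _ (ht.trans_le hn) j) (m * θ ^ 2 - 1)
  refine ⟨h1.div_const _, ?_⟩
  have hs : 0 < √m := Real.sqrt_pos.2 hm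
  simp only [excess]
  rw [integral_div, div_le_iff₀ (by positivity)]
  refine h2.trans ?_
  rw [neg_sub, sub_eq_add_neg, Real.exp_add]
  -- The factor `3 / 2` comes from `exp 1 ≤ 3` and from the tilt being at least `2 / √m`.
  have he : Real.exp 1 ≤ 3 := Real.exp_one_lt_d9.le.trans (by norm_num)
  have : 3 / 2 * (√m * Real.exp (-(m * θ ^ 2))) * (2 * θ + 2 / √m) =
      3 * Real.exp (-(m * θ ^ 2)) + 3 * √m * θ * Real.exp (-(m * θ ^ 2)) := by
    field_simp
    ring
  rw [this]
  have h4 : 0 ≤ 3 * √m * θ * Real.exp (-(m * θ ^ 2)) := by positivity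
  have h5 : Real.exp 1 * Real.exp (-(m * θ ^ 2)) ≤ 3 * Real.exp (-(m * θ ^ 2)) := by gcongr
  linarith

end Deviation

/-! ### Elementary sums -/

section Sums

/-- The exploration bonus of an arm with `n` samples, where `A` is the quotient of the length of
the run and the number of arms. -/
noncomputable def bonus (A : ℝ) (n : ℕ) : ℝ := √(max (Real.log (A / n)) 0 / n)

/-- The terms grow geometrically up to `2 ^ j ≈ A` and decay geometrically afterwards. With `x = √A`
and `y = √(2 ^ j)`, each term is at most the increment of the potential `7 x y / (x + y)`, which
never exceeds `7 x`. -/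
theorem sum_dyadic_le {A : ℝ} (hA : 0 < A) (J : ℕ) :
    ∑ j ∈ Finset.range J, √((2 : ℝ) ^ j) / (1 + 2 ^ j / A) ≤ 7 * √A := by
  have hs : 0 < √A := Real.sqrt_pos.2 hA
  have key : ∀ J : ℕ, ∑ j ∈ Finset.range J, √((2 : ℝ) ^ j) / (1 + 2 ^ j / A) ≤
      7 * √A * (√((2 : ℝ) ^ J) / (√A + √((2 : ℝ) ^ J))) := by
    intro J
    induction J with
    | zero => simp only [Finset.range_zero, Finset.sum_empty]; positivity
    | succ J ih =>
      rw [Finset.sum_range_succ]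
      have h2 : √((2 : ℝ) ^ (J + 1)) = √2 * √(2 ^ J) := by
        rw [pow_succ', Real.sqrt_mul (by norm_num)]
      have hp : (2 : ℝ) ^ J = √(2 ^ J) ^ 2 := (Real.sq_sqrt (by positivity)).symm
      have hAs : A = √A ^ 2 := (Real.sq_sqrt hA.le).symm
      have hy : 0 < √((2 : ℝ) ^ J) := Real.sqrt_pos.2 (by positivity)
      have e1 : √((2 : ℝ) ^ J) / (1 + 2 ^ J / A) =
          √((2 : ℝ) ^ J) * √A ^ 2 / (√A ^ 2 + √((2 : ℝ) ^ J) ^ 2) := by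
        rw [hp, ← hAs]
        simp only [Real.sqrt_sq hy.le]
        field_simp
      rw [e1, h2]
      set y := √((2 : ℝ) ^ J)
      set x := √A
      have hq : √(2 : ℝ) ^ 2 = 2 := Real.sq_sqrt (by norm_num)
      have hq1 : (1.414 : ℝ) ≤ √2 := Real.le_sqrt_of_sq_le (by norm_num)
      have hq2 : √(2 : ℝ) ≤ 1.415 := Real.sqrt_le_iff.2 ⟨by norm_num, by norm_num⟩
      set q := √(2 : ℝ)
      have e2 : 7 * x * (q * y / (x + q * y)) - 7 * x * (y / (x + y)) =
          7 * x ^ 2 * y * (q - 1) / ((x + q * y) * (x + y)) := by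
        field_simp; ring
      have e3 : y * x ^ 2 / (x ^ 2 + y ^ 2) ≤
          7 * x ^ 2 * y * (q - 1) / ((x + q * y) * (x + y)) := by
        rw [div_le_div_iff₀ (by positivity) (by positivity)]
        have : (x + q * y) * (x + y) ≤ 7 * (q - 1) * (x ^ 2 + y ^ 2) := by
          nlinarith [sq_nonneg (x - y), mul_pos hs hy, sq_nonneg x, sq_nonneg y]
        have h0 : 0 ≤ y * x ^ 2 := by positivity
        nlinarith [mul_le_mul_of_nonneg_left this h0]
      linarith
  refine (key J).trans ?_
  refine mul_le_of_le_one_right (by positivity) ((div_le_one (by positivity)).2 ?_)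
  linarith

/-- From `log u ≤ u - 1` at `u = r / q` one gets `log (A / n) ≤ √(A / n)`, so the bonus is at most
`A^(1/4) / n^(3/4)`, which is summable up to `n ≈ A` at the cost `√A`. Fourth roots avoid real
powers. -/
theorem bonus_le {A r q : ℝ} {n : ℕ} (hr : 0 < r) (hq : 0 < q) (hA : A = r ^ 4)
    (hn : (n : ℝ) = q ^ 4) : bonus A n ≤ r / q ^ 3 := by
  rw [bonus, hA, hn]
  refine Real.sqrt_le_iff.2 ⟨by positivity, ?_⟩
  have hlog : max (Real.log (r ^ 4 / q ^ 4)) 0 ≤ (r / q) ^ 2 := by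
    refine max_le ?_ (by positivity)
    rw [← div_pow, Real.log_pow]
    have := Real.log_le_sub_one_of_pos (div_pos hr hq)
    push_cast
    nlinarith [sq_nonneg (r / q - 2)]
  calc _ ≤ (r / q) ^ 2 / q ^ 4 := by gcongr
    _ = (r / q ^ 3) ^ 2 := by field_simp

theorem sum_bonus_le {A : ℝ} (hA : 0 < A) (N : ℕ) :
    ∑ i ∈ Finset.Ico 1 N, bonus A i ≤ 4 * √A := by
  have key : ∀ N : ℕ, ∑ i ∈ Finset.range N, bonus A (i + 1) ≤ 4 * √√A * √√(min (N : ℝ) A) := by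
    intro N
    induction N with
    | zero => simp [hA.le]
    | succ N ih =>
      rw [Finset.sum_range_succ]
      by_cases hN : ((N + 1 : ℕ) : ℝ) ≤ A
      · have hN' : (N : ℝ) ≤ A := by push_cast at hN; linarith
        rw [min_eq_left hN'] at ih
        rw [min_eq_left hN]
        have hr : 0 < √√A := by positivity
        have hq : 0 < √√((N + 1 : ℕ) : ℝ) := by positivity
        have four : ∀ x : ℝ, 0 ≤ x → x = √√x ^ 4 := fun x hx => by
          rw [show (4 : ℕ) = 2 * 2 from rfl, pow_mul, Real.sq_sqrt (Real.sqrt_nonneg _),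
            Real.sq_sqrt hx]
        have hb := bonus_le hr hq (four A hA.le) (four _ (Nat.cast_nonneg _))
        have hqN := four ((N + 1 : ℕ) : ℝ) (Nat.cast_nonneg _)
        have hpN := four (N : ℝ) (Nat.cast_nonneg _)
        have hp : 0 ≤ √√(N : ℝ) := by positivity
        have hpq : √√(N : ℝ) ≤ √√((N + 1 : ℕ) : ℝ) := by
          gcongr; simp
        have hdiff : √√((N + 1 : ℕ) : ℝ) ^ 4 - √√(N : ℝ) ^ 4 = 1 := by
          rw [← hqN, ← hpN]; push_cast; ring
        set q := √√((N + 1 : ℕ) : ℝ)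
        set p := √√(N : ℝ)
        set r := √√A
        -- Telescoping: the sum of `n^(-3/4)` is compared with the increments of `4 n^(1/4)`.
        have h1 : 1 / q ^ 3 ≤ 4 * (q - p) := by
          rw [div_le_iff₀ (by positivity), ← hdiff]
          have h0 : 0 ≤ q - p := sub_nonneg.2 hpq
          have e : q ^ 4 - p ^ 4 = (q - p) * (q ^ 3 + q ^ 2 * p + q * p ^ 2 + p ^ 3) := by ring
          rw [e, show 4 * (q - p) * q ^ 3 = (q - p) * (4 * q ^ 3) by ring]
          refine mul_le_mul_of_nonneg_left ?_ h0
          have a1 : p ^ 2 ≤ q ^ 2 := by gcongr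
          have a2 : p ^ 3 ≤ q ^ 3 := by gcongr
          nlinarith [mul_le_mul_of_nonneg_left hpq (sq_nonneg q),
            mul_le_mul_of_nonneg_left a1 hq.le]
        have h2 : r / q ^ 3 ≤ r * (4 * (q - p)) := by
          rw [div_eq_mul_one_div]; gcongr
        nlinarith
      -- Beyond `A` samples the logarithm is not positive and the bonus vanishes.
      · have h0 : bonus A (N + 1) = 0 := by
          rw [bonus, max_eq_right, zero_div, Real.sqrt_zero]
          exact Real.log_nonpos (by positivity)
            ((div_le_one (by positivity)).2 (not_le.1 hN).le)
        rw [h0, add_zero]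
        refine ih.trans ?_
        gcongr
        simp
  rw [Finset.sum_Ico_eq_sum_range]
  simp only [add_comm 1]
  refine (key _).trans ?_
  calc _ ≤ 4 * √√A * √√A := by gcongr; exact min_le_right _ _
    _ = 4 * √A := by rw [mul_assoc, Real.mul_self_sqrt (Real.sqrt_nonneg _)]

/-- Grouping the numbers `1, …, N - 1` by their binary lengths. -/
theorem sum_div_two_pow_log_le {f : ℕ → ℝ} (hf : ∀ j, 0 ≤ f j) {N J : ℕ} (hN : N ≤ 2 ^ J) :
    ∑ i ∈ Finset.Ico 1 N, f (Nat.log 2 i) / 2 ^ Nat.log 2 i ≤ ∑ j ∈ Finset.range J, f j := by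
  refine (Finset.sum_le_sum_of_subset_of_nonneg (Finset.Ico_subset_Ico_right hN)
    fun i _ _ => div_nonneg (hf _) (by positivity)).trans_eq ?_
  clear hN
  induction J with
  | zero => simp
  | succ J ih =>
    rw [← Finset.sum_Ico_consecutive _ (Nat.one_le_two_pow (n := J))
      (Nat.pow_le_pow_right two_pos J.le_succ), ih, Finset.sum_range_succ]
    congr 1
    have : ∀ i ∈ Finset.Ico (2 ^ J) (2 ^ (J + 1)),
        f (Nat.log 2 i) / 2 ^ Nat.log 2 i = f J / 2 ^ J := by
      intro i hi
      rw [Finset.mem_Ico] at hi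
      rw [Nat.log_eq_of_pow_le_of_lt_pow hi.1 hi.2]
    rw [Finset.sum_congr rfl this, Finset.sum_const, Nat.card_Ico, pow_succ, mul_two,
      Nat.add_sub_cancel, nsmul_eq_mul]
    push_cast
    field_simp

/-- The left side is the minimum of `2 m / A` and `1`. The right side is shaped so that, at `m = 2 ^
j`, the sum over the scales becomes that of `sum_dyadic_le`. -/
theorem exp_neg_max_log_le {A m : ℝ} (hA : 0 < A) (hm : 0 < m) :
    Real.exp (-max (Real.log (A / (2 * m))) 0) ≤ 4 / A * (m / (1 + m / A)) := by
  have e : 4 / A * (m / (1 + m / A)) = 4 * m / (A + m) := by field_simp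
  rw [e]
  rcases le_total m A with h | h
  · have h1 : Real.exp (-max (Real.log (A / (2 * m))) 0) ≤ 2 * m / A := by
      refine (Real.exp_le_exp.2 (neg_le_neg (le_max_left _ _))).trans_eq ?_
      rw [← Real.log_inv, Real.exp_log (by positivity), inv_div]
    refine h1.trans ?_
    rw [div_le_div_iff₀ hA (by positivity)]
    nlinarith
  · have h1 : Real.exp (-max (Real.log (A / (2 * m))) 0) ≤ 1 :=
      Real.exp_le_one_iff.2 (neg_nonpos.2 (le_max_right _ _))
    refine h1.trans ?_
    rw [le_div_iff₀ (by positivity)]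
    linarith

end Sums

/-! ### MOSS within one epoch -/

section Epoch

variable {K : ℕ} {E : Environment K} {ρ : Policy K}

/-- All selections of the history are possible selections of MOSS restarted every `τ` slots. -/
def IsMossHistory (τ : ℕ) : {n : ℕ} → History K n → Prop
  | 0, _ => True
  | n + 1, h => IsMossHistory τ (Fin.init h : History K n) ∧
      IsMossChoice τ (Fin.init h : History K n) (h (Fin.last n)).1

theorem measurableSet_isMossChoice_fst (τ n : ℕ) :
    MeasurableSet {p : History K n × (Fin K × ℝ) | IsMossChoice τ p.1 p.2.1} := by
  have : {p : History K n × (Fin K × ℝ) | IsMossChoice τ p.1 p.2.1} =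
      ⋃ k, ({h : History K n | IsMossChoice τ h k} ×ˢ (Prod.fst ⁻¹' {k})) := by
    ext p; simp
  rw [this]
  exact MeasurableSet.iUnion fun k => (measurableSet_isMossChoice τ k).prod
    (measurable_fst (measurableSet_singleton k))

theorem measurableSet_isMossHistory (τ n : ℕ) :
    MeasurableSet {h : History K n | IsMossHistory τ h} := by
  induction n with
  | zero => exact MeasurableSet.const _
  | succ n ih =>
    exact (measurable_init ih).inter ((measurable_init.prodMk (measurable_pi_apply _))
      (measurableSet_isMossChoice_fst τ n))

/-- After this the selection rule is used path by path; order of sampling, ties and randomization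
play no further role. -/
theorem IsResettingMoss.ae_isMossHistory {τ : ℕ} (hρ : IsResettingMoss ρ τ) (n : ℕ) :
    ∀ᵐ h ∂(historyLaw E ρ n), IsMossHistory τ h := by
  induction n with
  | zero => exact ae_of_all _ fun _ => trivial
  | succ n ih =>
    rw [historyLaw, ae_map_iff measurable_extend.aemeasurable (measurableSet_isMossHistory τ _),
      Measure.ae_compProd_iff (p := fun p => IsMossHistory τ (extend p))
        (measurable_extend (measurableSet_isMossHistory τ _))]
    filter_upwards [ih] with h hh
    have hm : MeasurableSet {o : Fin K × ℝ | IsMossHistory τ (extend (h, o))} :=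
      (measurable_extend.comp measurable_prodMk_left) (measurableSet_isMossHistory τ _)
    rw [stepKernel, Kernel.ae_compProd_iff hm]
    filter_upwards [hρ n h] with k hk
    exact ae_of_all _ fun x => by simp [IsMossHistory, hh, hk]

theorem epochCount_eq_countFrom {τ s₀ n : ℕ} (hs : τ * (n / τ) = s₀) (h : History K n)
    (k : Fin K) : epochCount τ h k = countFrom s₀ k h := by
  rw [epochCount, epochSamples, hs, Finset.card_filter, countFrom]

theorem sum_epochSamples_eq {τ s₀ n : ℕ} (hs : τ * (n / τ) = s₀) (h : History K n) (k : Fin K) :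
    ∑ s ∈ epochSamples τ h k, (h s).2 =
      cumul (noise E s₀ k) h + ∑ s ∈ epochSamples τ h k, mean E s k := by
  simp only [epochSamples, hs, cumul, Finset.sum_filter, ← Finset.sum_add_distrib, noise]
  refine Finset.sum_congr rfl fun s _ => ?_
  split_ifs <;> simp

/-- The empirical mean of an arm differs from a reference value by the normalized noise sum, up to
the variation of the true mean. -/
theorem abs_epochMean_sub_le {τ s₀ n : ℕ} (hs : τ * (n / τ) = s₀) (h : History K n) (k : Fin K)
    {v V : ℝ} (hV : ∀ t, s₀ ≤ t → t < n → |mean E t k - v| ≤ V) (hN : countFrom s₀ k h ≠ 0) :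
    |epochMean τ h k - (v + cumul (noise E s₀ k) h / countFrom s₀ k h)| ≤ V := by
  have hN0 : (0 : ℝ) < countFrom s₀ k h := by exact_mod_cast Nat.pos_of_ne_zero hN
  have hcard : ((epochSamples τ h k).card : ℝ) = countFrom s₀ k h := by
    rw [← epochCount_eq_countFrom hs h k, epochCount]
  have e : epochMean τ h k - (v + cumul (noise E s₀ k) h / countFrom s₀ k h) =
      (∑ s ∈ epochSamples τ h k, (mean E s k - v)) / countFrom s₀ k h := by
    rw [epochMean, sum_epochSamples_eq (E := E) hs, epochCount_eq_countFrom hs,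
      Finset.sum_sub_distrib, Finset.sum_const, nsmul_eq_mul, hcard]
    field_simp
    ring
  rw [e, abs_div, abs_of_pos hN0, div_le_iff₀ hN0]
  refine (Finset.abs_sum_le_sum_abs _ _).trans ?_
  refine (Finset.sum_le_card_nsmul _ _ V fun s hsm => ?_).trans_eq ?_
  · rw [epochSamples, hs] at hsm
    exact hV s (Finset.mem_filter.1 hsm).2.1 s.2
  · rw [nsmul_eq_mul, hcard, mul_comm]

theorem mossIndex_eq {τ s₀ n : ℕ} (hs : τ * (n / τ) = s₀) (h : History K n) (k : Fin K) :
    mossIndex τ h k = epochMean τ h k + bonus ((τ : ℝ) / K) (countFrom s₀ k h) := by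
  rw [mossIndex, bonus, epochCount_eq_countFrom hs, div_div]

/-- The excess of the noise sum of arm `k` at the dyadic sample size `2 ^ j`. -/
noncomputable def overshoot (E : Environment K) (s₀ : ℕ) (A : ℝ) (k : Fin K) (j : ℕ) {n : ℕ}
    (h : History K n) : ℝ :=
  excess E s₀ k 1 (2 ^ j) (1 / √A) h

/-- The excess of the negative of the noise sum of arm `k` over the exploration bonus at the dyadic
sample size `2 ^ j`. -/
noncomputable def undershoot (E : Environment K) (s₀ : ℕ) (A : ℝ) (k : Fin K) (j : ℕ) {n : ℕ}
    (h : History K n) : ℝ :=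
  excess E s₀ k (-1) (2 ^ j) √(max (Real.log (A / (2 * 2 ^ j))) 0 / 2 ^ j) h

theorem overshoot_nonneg (s₀ : ℕ) (A : ℝ) (k : Fin K) (j : ℕ) {n : ℕ} (h : History K n) :
    0 ≤ overshoot E s₀ A k j h := excess_nonneg _ _ _ _ (by positivity) h

theorem undershoot_nonneg (s₀ : ℕ) (A : ℝ) (k : Fin K) (j : ℕ) {n : ℕ} (h : History K n) :
    0 ≤ undershoot E s₀ A k j h := excess_nonneg _ _ _ _ (by positivity) h

theorem overshoot_le_extend (s₀ : ℕ) (A : ℝ) (k : Fin K) (j : ℕ) {n : ℕ} (h : History K n)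
    (o : Fin K × ℝ) : overshoot E s₀ A k j h ≤ overshoot E s₀ A k j (extend (h, o)) :=
  excess_le_extend _ _ _ _ (by positivity) h o

theorem undershoot_le_extend (s₀ : ℕ) (A : ℝ) (k : Fin K) (j : ℕ) {n : ℕ} (h : History K n)
    (o : Fin K × ℝ) : undershoot E s₀ A k j h ≤ undershoot E s₀ A k j (extend (h, o)) :=
  excess_le_extend _ _ _ _ (by positivity) h o

theorem two_pow_log_bounds {N : ℕ} (hN : N ≠ 0) :
    (2 : ℝ) ^ Nat.log 2 N ≤ N ∧ (N : ℝ) ≤ 2 * 2 ^ Nat.log 2 N := by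
  constructor
  · exact_mod_cast Nat.pow_log_le_self 2 hN
  · have := (Nat.lt_pow_succ_log_self one_lt_two N).le
    rw [Nat.succ_eq_add_one, pow_succ'] at this
    exact_mod_cast this

/-- The count lies between `m` and `2 m` for a power `m` of two: the upper bound limits the
compensator, the lower one the quotient. -/
theorem noise_div_count_le (s₀ : ℕ) {A : ℝ} (k : Fin K) {n : ℕ} (h : History K n)
    (hN : countFrom s₀ k h ≠ 0) :
    cumul (noise E s₀ k) h / countFrom s₀ k h ≤ 1 / √A +
      overshoot E s₀ A k (Nat.log 2 (countFrom s₀ k h)) h / 2 ^ Nat.log 2 (countFrom s₀ k h) := by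
  obtain ⟨h1, h2⟩ := two_pow_log_bounds hN
  set m : ℝ := 2 ^ Nat.log 2 (countFrom s₀ k h) with hm
  have hm0 : 0 < m := by positivity
  have hS := mul_cumul_noise_le (E := E) (σ := 1) (θ := 1 / √A) s₀ k (by norm_num) hm0
    (by positivity) h h2
  rw [one_mul] at hS
  have hU := overshoot_nonneg (E := E) s₀ A k (Nat.log 2 (countFrom s₀ k h)) h
  change _ ≤ m * (1 / √A) + overshoot E s₀ A k (Nat.log 2 (countFrom s₀ k h)) h at hS
  set U := overshoot E s₀ A k (Nat.log 2 (countFrom s₀ k h)) h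
  calc _ ≤ (m * (1 / √A) + U) / countFrom s₀ k h := by gcongr
    _ ≤ (m * (1 / √A) + U) / m := by gcongr
    _ = 1 / √A + U / m := by field_simp

theorem neg_noise_div_count_le (s₀ : ℕ) {A : ℝ} (hA : 0 < A) (k : Fin K) {n : ℕ}
    (h : History K n) (hN : countFrom s₀ k h ≠ 0) :
    -(cumul (noise E s₀ k) h / countFrom s₀ k h) ≤ bonus A (countFrom s₀ k h) +
      undershoot E s₀ A k (Nat.log 2 (countFrom s₀ k h)) h / 2 ^ Nat.log 2 (countFrom s₀ k h) := by
  obtain ⟨h1, h2⟩ := two_pow_log_bounds hN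
  have hN0 : (0 : ℝ) < countFrom s₀ k h := by exact_mod_cast Nat.pos_of_ne_zero hN
  set m : ℝ := 2 ^ Nat.log 2 (countFrom s₀ k h) with hm
  have hm0 : 0 < m := by positivity
  have hS := mul_cumul_noise_le (E := E) (σ := -1)
    (θ := √(max (Real.log (A / (2 * m))) 0 / m)) s₀ k (by norm_num) hm0 (by positivity) h h2
  rw [neg_one_mul] at hS
  have hU := undershoot_nonneg (E := E) s₀ A k (Nat.log 2 (countFrom s₀ k h)) h
  change _ ≤ m * √(max (Real.log (A / (2 * m))) 0 / m) +
    undershoot E s₀ A k (Nat.log 2 (countFrom s₀ k h)) h at hS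
  set U := undershoot E s₀ A k (Nat.log 2 (countFrom s₀ k h)) h
  -- The level of `undershoot` uses `A / (2 m)`, not `A / m`, so that it stays below the actual
  -- bonus for every count in `[m, 2 m]`.
  have hb : m * √(max (Real.log (A / (2 * m))) 0 / m) ≤
      countFrom s₀ k h * bonus A (countFrom s₀ k h) := by
    have aux : ∀ x y : ℝ, 0 < x → x * √(y / x) = √(x * y) := fun x y hx => by
      rw [← Real.sqrt_sq hx.le, ← Real.sqrt_mul (sq_nonneg _), Real.sqrt_sq hx.le]
      congr 1; field_simp
    rw [bonus, aux _ _ hm0, aux _ _ hN0]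
    have : Real.log (A / (2 * m)) ≤ Real.log (A / countFrom s₀ k h) :=
      Real.log_le_log (by positivity) (by gcongr)
    gcongr
  rw [← neg_div, div_le_iff₀ hN0, add_mul]
  have h3 : U ≤ U / m * countFrom s₀ k h := by
    rw [div_mul_eq_mul_div, le_div_iff₀ hm0]; gcongr
  linarith

/-- The gap of an arm with maximal index. -/
theorem gap_le_of_mossIndex_le {τ s₀ n J : ℕ} {A V : ℝ} (hA : A = (τ : ℝ) / K) (hA0 : 0 < A)
    (hs : τ * (n / τ) = s₀) (h : History K n) {k j : Fin K} {v : Fin K → ℝ}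
    (hV : ∀ t, s₀ ≤ t → t < n → ∀ i, |mean E t i - v i| ≤ V)
    (hk : countFrom s₀ k h ≠ 0) (hj : countFrom s₀ j h ≠ 0) (hJ : countFrom s₀ j h < 2 ^ J)
    (hi : mossIndex τ h j ≤ mossIndex τ h k) :
    v j - v k ≤ 2 * V + 1 / √A + (∑ l ∈ Finset.range J, undershoot E s₀ A j l h / 2 ^ l) +
      (bonus A (countFrom s₀ k h) +
        overshoot E s₀ A k (Nat.log 2 (countFrom s₀ k h)) h /
          2 ^ Nat.log 2 (countFrom s₀ k h)) := by
  rw [mossIndex_eq hs, mossIndex_eq hs, ← hA] at hi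
  have h1 := abs_le.1 (abs_epochMean_sub_le (E := E) hs h k (fun t a b => hV t a b k) hk)
  have h2 := abs_le.1 (abs_epochMean_sub_le (E := E) hs h j (fun t a b => hV t a b j) hj)
  have h3 := noise_div_count_le (E := E) (A := A) s₀ k h hk
  have h4 := neg_noise_div_count_le (E := E) s₀ hA0 j h hj
  -- The scale of the best arm is random, so it is replaced by the sum over all scales, which is the
  -- same for every slot.
  have h5 : undershoot E s₀ A j (Nat.log 2 (countFrom s₀ j h)) h /
      2 ^ Nat.log 2 (countFrom s₀ j h) ≤
      ∑ l ∈ Finset.range J, undershoot E s₀ A j l h / 2 ^ l :=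
    Finset.single_le_sum (f := fun l => undershoot E s₀ A j l h / 2 ^ l)
      (fun l _ => div_nonneg (undershoot_nonneg s₀ A j l h) (by positivity))
      (Finset.mem_range.2 ((Nat.log_lt_iff_lt_pow one_lt_two hj).2 hJ))
  linarith [h1.1, h1.2, h2.1, h2.2]

end Epoch

/-! ### Pathwise bound for the cumulative gap of an epoch -/

section EpochRegret

variable {K : ℕ} {E : Environment K} {ρ : Policy K}

theorem IsSubGaussianEnv.gap_le {a b : ℝ} {T : ℕ} (hE : IsSubGaussianEnv E a b T) {t : ℕ}
    (ht : t < T) (k : Fin K) : bestMean E t - mean E t k ≤ b := by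
  have : Nonempty (Fin K) := ⟨k⟩
  have h1 : bestMean E t ≤ a + b := ciSup_le fun j => (hE t ht j).2.2
  have h2 := (hE t ht k).2.1
  linarith

/-- The arms selected from slot `s₀` on. -/
def usedArms (s₀ : ℕ) {n : ℕ} (h : History K n) : Finset (Fin K) := {k | countFrom s₀ k h ≠ 0}

theorem usedArms_subset_extend (s₀ : ℕ) {n : ℕ} (h : History K n) (o : Fin K × ℝ) :
    usedArms s₀ h ⊆ usedArms s₀ (extend (h, o)) := by
  intro k hk
  simp only [usedArms, Finset.mem_filter, Finset.mem_univ, true_and, countFrom_extend] at hk ⊢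
  omega

theorem usedArms_extend {s₀ n : ℕ} (hn : s₀ ≤ n) (h : History K n) (o : Fin K × ℝ) :
    usedArms s₀ (extend (h, o)) = insert o.1 (usedArms s₀ h) := by
  ext k
  simp only [usedArms, Finset.mem_filter, Finset.mem_univ, true_and, countFrom_extend,
    Finset.mem_insert, hn]
  by_cases hk : o.1 = k
  · simp [hk]
  · simp [hk, Ne.symm hk]

theorem card_usedArms_le (s₀ d : ℕ) (h : History K (s₀ + d)) : (usedArms s₀ h).card ≤ d := by
  induction d with
  | zero =>
    have : usedArms s₀ h = ∅ := by
      ext k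
      have hc : countFrom s₀ k h = 0 := countFrom_of_le (Nat.le_refl _) k h
      simpa [usedArms] using hc
    simp [this]
  | succ d ih =>
    have e := extend_init (n := s₀ + d) h
    rw [← e, usedArms_extend (Nat.le_add_right _ _)]
    exact (Finset.card_insert_le _ _).trans (Nat.succ_le_succ (ih _))

/-- The contribution of the samples of arm `k` to the bound for the regret of an epoch. -/
noncomputable def sampleCost (E : Environment K) (s₀ : ℕ) (A : ℝ) (k : Fin K) {n : ℕ}
    (h : History K n) : ℝ :=
  ∑ i ∈ Finset.Ico 1 (countFrom s₀ k h),
    (bonus A i + overshoot E s₀ A k (Nat.log 2 i) h / 2 ^ Nat.log 2 i)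

/-- The next sample of an arm adds one term, indexed by its previous count. Earlier terms only grow,
because overshoots are running maxima; hence the pathwise bound can be proved slot by slot. -/
theorem sampleCost_add_le (s₀ : ℕ) (A : ℝ) {n : ℕ} (hn : s₀ ≤ n) (h : History K n)
    (o : Fin K × ℝ) (k : Fin K) :
    sampleCost E s₀ A k h + (if o.1 = k then (if countFrom s₀ k h = 0 then 0 else
      bonus A (countFrom s₀ k h) + overshoot E s₀ A k (Nat.log 2 (countFrom s₀ k h)) h /
        2 ^ Nat.log 2 (countFrom s₀ k h)) else 0) ≤ sampleCost E s₀ A k (extend (h, o)) := by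
  have hmono : ∀ i, bonus A i + overshoot E s₀ A k (Nat.log 2 i) h / 2 ^ Nat.log 2 i ≤
      bonus A i + overshoot E s₀ A k (Nat.log 2 i) (extend (h, o)) / 2 ^ Nat.log 2 i := fun i => by
    have := overshoot_le_extend (E := E) s₀ A k (Nat.log 2 i) h o
    gcongr
  simp only [sampleCost, countFrom_extend, hn, true_and]
  by_cases hk : o.1 = k
  · simp only [hk, if_true]
    by_cases h0 : countFrom s₀ k h = 0
    · simp [h0]
    · rw [if_neg h0, Finset.sum_Ico_succ_top (Nat.one_le_iff_ne_zero.2 h0)]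
      exact add_le_add (Finset.sum_le_sum fun i _ => hmono i) (hmono _)
  · simp only [hk, if_false, add_zero]
    exact Finset.sum_le_sum fun i _ => hmono i

theorem cumul_gapFrom_of_le {s₀ n : ℕ} (hn : n ≤ s₀) (h : History K n) :
    cumul (gapFrom E s₀) h = 0 := by
  refine Finset.sum_eq_zero fun s _ => ?_
  rw [gapFrom, if_neg]
  have := s.2
  omega

/-- A bound for the cumulative gap of the first `d` slots of an epoch, valid for every history that
MOSS can produce. -/
theorem cumul_gapFrom_le {a b A V : ℝ} {T τ i s₀ J : ℕ} (hb : 0 ≤ b) (hs₀ : s₀ = τ * i)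
    (hE : IsSubGaussianEnv E a b T) (hA : A = (τ : ℝ) / K) (hA0 : 0 < A) (hJ : τ ≤ 2 ^ J)
    (hV0 : 0 ≤ V)
    (hV : ∀ t, s₀ ≤ t → t < s₀ + τ → t < T → ∀ k, |mean E t k - mean E (s₀) k| ≤ V)
    {j : Fin K} (hj : ∀ k, mean E (s₀) k ≤ mean E (s₀) j) (d : ℕ) (hd : d ≤ τ)
    (hT : s₀ + d ≤ T) (h : History K (s₀ + d)) (hh : IsMossHistory τ h) :
    cumul (gapFrom E (s₀)) h ≤ b * (usedArms (s₀) h).card +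
      d * (4 * V + 1 / √A + ∑ l ∈ Finset.range J, undershoot E (s₀) A j l h / 2 ^ l) +
      ∑ k, sampleCost E (s₀) A k h := by
  induction d with
  | zero =>
    rw [cumul_gapFrom_of_le (Nat.le_refl _)]
    have : ∀ k, sampleCost E (s₀) A k h = 0 := fun k => by
      have hc : countFrom s₀ k h = 0 := countFrom_of_le (Nat.le_refl _) k h
      rw [sampleCost, hc]
      simp
    simp only [this, Nat.cast_zero, zero_mul, Finset.sum_const_zero, add_zero]
    positivity
  | succ d ih =>
    have e := extend_init (n := s₀ + d) h
    obtain ⟨hh1, hh2⟩ := hh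
    specialize ih (Nat.le_of_succ_le hd) (Nat.le_of_succ_le hT) _ hh1
    set g : History K (s₀ + d) := Fin.init h with hg
    set o := h (Fin.last (s₀ + d)) with ho
    rw [← e]
    have hs : τ * ((s₀ + d) / τ) = s₀ := by
      have hτ : 0 < τ := by omega
      rw [hs₀, Nat.mul_add_div hτ, Nat.div_eq_of_lt (by omega), add_zero]
    have hZ : ∑ l ∈ Finset.range J, undershoot E s₀ A j l g / 2 ^ l ≤
        ∑ l ∈ Finset.range J, undershoot E s₀ A j l (extend (g, o)) / 2 ^ l := by
      refine Finset.sum_le_sum fun l _ => ?_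
      have := undershoot_le_extend (E := E) s₀ A j l g o
      gcongr
    have hZ0 : 0 ≤ ∑ l ∈ Finset.range J, undershoot E s₀ A j l g / 2 ^ l :=
      Finset.sum_nonneg fun l _ => div_nonneg (undershoot_nonneg _ _ _ _ _) (by positivity)
    set Z := ∑ l ∈ Finset.range J, undershoot E s₀ A j l g / 2 ^ l
    set Z' := ∑ l ∈ Finset.range J, undershoot E s₀ A j l (extend (g, o)) / 2 ^ l
    have hC : ∑ k, sampleCost E s₀ A k g + (if countFrom s₀ o.1 g = 0 then 0 else
        bonus A (countFrom s₀ o.1 g) + overshoot E s₀ A o.1 (Nat.log 2 (countFrom s₀ o.1 g)) g /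
          2 ^ Nat.log 2 (countFrom s₀ o.1 g)) ≤ ∑ k, sampleCost E s₀ A k (extend (g, o)) := by
      have := Finset.sum_le_sum fun k (_ : k ∈ Finset.univ) =>
        sampleCost_add_le (E := E) s₀ A (Nat.le_add_right s₀ d) g o k
      rw [Finset.sum_add_distrib, Finset.sum_ite_eq Finset.univ o.1] at this
      simpa using this
    rw [cumul_extend, gapFrom, if_pos (Nat.le_add_right _ _)]
    have hdZ : (d : ℝ) * (4 * V + 1 / √A + Z) ≤ d * (4 * V + 1 / √A + Z') := by gcongr
    have hexp : ((d + 1 : ℕ) : ℝ) * (4 * V + 1 / √A + Z') =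
        d * (4 * V + 1 / √A + Z') + (4 * V + 1 / √A + Z') := by push_cast; ring
    rw [hexp]
    have hVA : 0 ≤ 1 / √A := by positivity
    -- A first sample is charged `b` through the number of used arms. Later samples are charged
    -- through the indices, with drift `2 V` from the empirical means and `2 V` from the means of
    -- the current slot.
    by_cases h0 : countFrom s₀ o.1 g = 0
    · rw [if_pos h0] at hC
      have hgap := hE.gap_le (t := s₀ + d) (by omega) o.1
      have hcard : (usedArms s₀ (extend (g, o))).card = (usedArms s₀ g).card + 1 := by
        rw [usedArms_extend (Nat.le_add_right _ _), Finset.card_insert_of_notMem]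
        simp [usedArms, h0]
      rw [hcard]
      push_cast
      linarith
    · rw [if_neg h0] at hC
      have hcard : ((usedArms s₀ g).card : ℝ) ≤ (usedArms s₀ (extend (g, o))).card := by
        exact_mod_cast Finset.card_le_card (usedArms_subset_extend s₀ g o)
      have hbc := mul_le_mul_of_nonneg_left hcard hb
      rcases hh2 with hc | ⟨hall, hmax⟩
      · exact absurd ((epochCount_eq_countFrom hs g o.1).symm.trans hc) h0
      have hVn : ∀ t, s₀ ≤ t → t < s₀ + d → ∀ k, |mean E t k - mean E s₀ k| ≤ V :=
        fun t h1 h2 => hV t h1 (by omega) (by omega)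
      have hjc : countFrom s₀ j g ≠ 0 := by
        rw [← epochCount_eq_countFrom hs]; exact hall j
      have hlt : countFrom s₀ j g < 2 ^ J :=
        ((countFrom_le s₀ (s₀ + d) j g).trans_lt (by omega)).trans_le hJ
      have hgap := gap_le_of_mossIndex_le hA hA0 hs g hVn h0 hjc hlt (hmax j)
      have hnow := hV (s₀ + d) (Nat.le_add_right _ _) (by omega) (by omega)
      have : Nonempty (Fin K) := ⟨j⟩
      have hbest : bestMean E (s₀ + d) ≤ mean E s₀ j + V :=
        ciSup_le fun k => by linarith [(abs_le.1 (hnow k)).2, hj k]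
      have hlow := (abs_le.1 (hnow o.1)).1
      linarith

end EpochRegret

/-! ### Expected regret of an epoch and of the whole run -/

section UpperBound

variable {K : ℕ} {E : Environment K} {ρ : Policy K}

theorem sum_integral_overshoot_le {a b A : ℝ} {T n : ℕ} (hE : IsSubGaussianEnv E a b T)
    (hA : 0 < A) (hn : n ≤ T) (s₀ : ℕ) (k : Fin K) (J : ℕ) :
    ∑ j ∈ Finset.range J, ∫ h : History K n, overshoot E s₀ A k j h ∂(historyLaw E ρ n) ≤
      11 * √A := by
  have h1 : ∀ j ∈ Finset.range J,
      ∫ h : History K n, overshoot E s₀ A k j h ∂(historyLaw E ρ n) ≤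
        3 / 2 * (√((2 : ℝ) ^ j) / (1 + 2 ^ j / A)) := by
    intro j _
    refine ((integral_excess_le hE s₀ k 1 (by positivity) (by positivity) hn).2).trans ?_
    rw [div_eq_mul_inv (√((2 : ℝ) ^ j))]
    gcongr
    -- Here `exp (-u) ≤ 1 / (1 + u)` with `u = 2 ^ j / A` brings the bound into the form of the
    -- dyadic sum.
    rw [Real.exp_neg, div_pow, one_pow, Real.sq_sqrt hA.le, mul_one_div]
    gcongr
    linarith [Real.add_one_le_exp ((2 : ℝ) ^ j / A)]
  refine (Finset.sum_le_sum h1).trans ?_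
  rw [← Finset.mul_sum]
  nlinarith [sum_dyadic_le hA J, Real.sqrt_nonneg A]

theorem sum_integral_undershoot_le {a b A : ℝ} {T n : ℕ} (hE : IsSubGaussianEnv E a b T)
    (hA : 0 < A) (hn : n ≤ T) (s₀ : ℕ) (k : Fin K) (J : ℕ) :
    ∑ j ∈ Finset.range J,
      (∫ h : History K n, undershoot E s₀ A k j h ∂(historyLaw E ρ n)) / 2 ^ j ≤ 42 / √A := by
  have h1 : ∀ j ∈ Finset.range J,
      (∫ h : History K n, undershoot E s₀ A k j h ∂(historyLaw E ρ n)) / 2 ^ j ≤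
        6 / A * (√((2 : ℝ) ^ j) / (1 + 2 ^ j / A)) := by
    intro j _
    rw [div_le_iff₀ (by positivity)]
    refine ((integral_excess_le hE s₀ k (-1) (by positivity) (by positivity) hn).2).trans ?_
    rw [Real.sq_sqrt (by positivity), mul_div_cancel₀ _ (by positivity)]
    calc _ ≤ 3 / 2 * (√((2 : ℝ) ^ j) * (4 / A * (2 ^ j / (1 + 2 ^ j / A)))) := by
          gcongr
          exact exp_neg_max_log_le hA (by positivity)
      _ = _ := by ring
  refine (Finset.sum_le_sum h1).trans ?_
  rw [← Finset.mul_sum]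
  calc _ ≤ 6 / A * (7 * √A) := by gcongr; exact sum_dyadic_le hA J
    _ = 42 / √A := by
      have : A = √A ^ 2 := (Real.sq_sqrt hA.le).symm
      have hs : 0 < √A := Real.sqrt_pos.2 hA
      rw [div_mul_eq_mul_div, div_eq_div_iff hA.ne' hs.ne']
      linear_combination (-42) * this

/-- At most `2 ^ j` sample sizes have scale `j` and each pays the overshoot divided by `2 ^ j`, so
every scale is paid at most once. -/
theorem sampleCost_le {A : ℝ} (hA : 0 < A) {s₀ n J : ℕ} (k : Fin K) (h : History K n)
    (hJ : countFrom s₀ k h ≤ 2 ^ J) :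
    sampleCost E s₀ A k h ≤ 4 * √A + ∑ j ∈ Finset.range J, overshoot E s₀ A k j h := by
  rw [sampleCost, Finset.sum_add_distrib]
  exact add_le_add (sum_bonus_le hA _)
    (sum_div_two_pow_log_le (fun j => overshoot_nonneg s₀ A k j h) hJ)

/-- The regret of MOSS in the first `d` slots of an epoch. -/
theorem epoch_regret_le {a b V : ℝ} {T τ i : ℕ} (hK : 0 < K) (hτ : 0 < τ) (hb : 0 ≤ b)
    (hE : IsSubGaussianEnv E a b T) (hρ : IsResettingMoss ρ τ) (hV0 : 0 ≤ V)
    (hV : ∀ t, τ * i ≤ t → t < τ * i + τ → t < T → ∀ k, |mean E t k - mean E (τ * i) k| ≤ V)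
    (d : ℕ) (hd : d ≤ τ) (hT : τ * i + d ≤ T) :
    ∑ t ∈ Finset.Ico (τ * i) (τ * i + d), ∑ k, armProb E ρ t k * (bestMean E t - mean E t k) ≤
      (b + 58) * √(K * τ) + 4 * τ * V := by
  have : Nonempty (Fin K) := ⟨⟨0, hK⟩⟩
  obtain ⟨j, hj⟩ := Finite.exists_max fun k => mean E (τ * i) k
  -- Any number of scales that covers the epoch will do, since the bounds on the sums do not depend
  -- on `J`.
  obtain ⟨J, hJ⟩ : ∃ J : ℕ, τ ≤ 2 ^ J := ⟨τ, Nat.lt_two_pow_self.le⟩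
  have hK0 : (0 : ℝ) < K := by exact_mod_cast hK
  have hτ0 : (0 : ℝ) < τ := by exact_mod_cast hτ
  obtain ⟨A, hA⟩ : ∃ A : ℝ, A = (τ : ℝ) / K := ⟨_, rfl⟩
  have hA0 : 0 < A := by rw [hA]; positivity
  obtain ⟨s₀, hs₀⟩ : ∃ s₀, s₀ = τ * i := ⟨_, rfl⟩
  rw [← hs₀] at hj hV hT ⊢
  obtain ⟨hint, heq⟩ := integral_cumul_gapFrom (E := E) (ρ := ρ) s₀ (s₀ + d)
  rw [← heq]
  have hov : ∀ k l, Integrable (fun h : History K (s₀ + d) => overshoot E s₀ A k l h)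
      (historyLaw E ρ (s₀ + d)) := fun k l =>
    (integral_excess_le hE s₀ k 1 (by positivity) (by positivity) hT).1
  have hun : ∀ l, Integrable (fun h : History K (s₀ + d) => undershoot E s₀ A j l h / 2 ^ l)
      (historyLaw E ρ (s₀ + d)) := fun l =>
    ((integral_excess_le hE s₀ j (-1) (by positivity) (by positivity) hT).1).div_const _
  have hle : ∀ᵐ h ∂(historyLaw E ρ (s₀ + d)), cumul (gapFrom E s₀) h ≤
      (b * √(K * τ) + τ * (4 * V + 1 / √A) + K * (4 * √A)) +
        (τ * ∑ l ∈ Finset.range J, undershoot E s₀ A j l h / 2 ^ l +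
          ∑ k, ∑ l ∈ Finset.range J, overshoot E s₀ A k l h) := by
    filter_upwards [hρ.ae_isMossHistory (s₀ + d)] with h hh
    refine (cumul_gapFrom_le hb hs₀ hE hA hA0 hJ hV0 hV hj d hd hT h hh).trans ?_
    -- The number of used arms is at most `K` and at most `τ`, hence at most their geometric mean;
    -- epochs too short to try every arm are covered.
    have h1 : ((usedArms s₀ h).card : ℝ) ≤ √(K * τ) := by
      refine Real.le_sqrt_of_sq_le ?_
      have c1 : (usedArms s₀ h).card ≤ K := by
        simpa using Finset.card_le_univ (usedArms s₀ h)
      have c2 := (card_usedArms_le s₀ d h).trans hd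
      rw [sq]
      exact_mod_cast Nat.mul_le_mul c1 c2
    have h2 : ∑ k, sampleCost E s₀ A k h ≤
        K * (4 * √A) + ∑ k, ∑ l ∈ Finset.range J, overshoot E s₀ A k l h := by
      refine (Finset.sum_le_sum fun k _ => sampleCost_le hA0 (J := J) k h ?_).trans_eq ?_
      · exact ((countFrom_le s₀ _ k h).trans (by omega)).trans hJ
      · rw [Finset.sum_add_distrib]; simp
    have h3 : 0 ≤ ∑ l ∈ Finset.range J, undershoot E s₀ A j l h / 2 ^ l :=
      Finset.sum_nonneg fun l _ => div_nonneg (undershoot_nonneg _ _ _ _ _) (by positivity)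
    have h4 : (d : ℝ) ≤ τ := by exact_mod_cast hd
    have h5 : (d : ℝ) * (4 * V + 1 / √A + ∑ l ∈ Finset.range J, undershoot E s₀ A j l h / 2 ^ l) ≤
        τ * (4 * V + 1 / √A + ∑ l ∈ Finset.range J, undershoot E s₀ A j l h / 2 ^ l) := by
      gcongr
    have h6 := mul_le_mul_of_nonneg_left h1 hb
    linarith
  have i1 := (integrable_finsetSum (Finset.range J) fun l _ => hun l).const_mul (τ : ℝ)
  have i2 := integrable_finsetSum Finset.univ fun k _ =>
    integrable_finsetSum (Finset.range J) fun l _ => hov k l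
  have i12 : Integrable (fun h : History K (s₀ + d) =>
      τ * ∑ l ∈ Finset.range J, undershoot E s₀ A j l h / 2 ^ l +
        ∑ k, ∑ l ∈ Finset.range J, overshoot E s₀ A k l h) (historyLaw E ρ (s₀ + d)) := i1.add i2
  refine (integral_mono_ae hint ((integrable_const _).add i12) hle).trans ?_
  simp only [Pi.add_apply]
  rw [integral_add (integrable_const _) i12, integral_add i1 i2, integral_const_mul,
    integral_finsetSum _ fun l _ => hun l, integral_finsetSum _ fun k _ =>
    integrable_finsetSum (Finset.range J) fun l _ => hov k l]
  have e1 : ∀ k, ∫ h, ∑ l ∈ Finset.range J, overshoot E s₀ A k l h ∂(historyLaw E ρ (s₀ + d)) ≤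
      11 * √A := fun k => by
    rw [integral_finsetSum _ fun l _ => hov k l]
    exact sum_integral_overshoot_le hE hA0 hT s₀ k J
  have e2 := sum_integral_undershoot_le (ρ := ρ) hE hA0 hT s₀ j J
  simp only [integral_div, integral_const, probReal_univ, one_smul]
  have e3 := Finset.sum_le_sum fun k (_ : k ∈ Finset.univ) => e1 k
  simp only [Finset.sum_const, Finset.card_univ, Fintype.card_fin, nsmul_eq_mul] at e3
  have e4 := mul_le_mul_of_nonneg_left e2 hτ0.le
  have hsK : 0 < √(K : ℝ) := Real.sqrt_pos.2 hK0
  have hsτ : 0 < √(τ : ℝ) := Real.sqrt_pos.2 hτ0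
  have hKs : (K : ℝ) = √(K : ℝ) ^ 2 := (Real.sq_sqrt hK0.le).symm
  have hτs : (τ : ℝ) = √(τ : ℝ) ^ 2 := (Real.sq_sqrt hτ0.le).symm
  have hAs : √A = √(τ : ℝ) / √(K : ℝ) := by rw [hA, Real.sqrt_div hτ0.le]
  have e5 : (K : ℝ) * √A = √(K * τ) := by
    rw [Real.sqrt_mul hK0.le, hAs]
    field_simp
    linear_combination hKs
  have e6 : (τ : ℝ) * (1 / √A) = √(K * τ) := by
    rw [Real.sqrt_mul hK0.le, hAs]
    field_simp
    linear_combination hτs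
  have e7 : (τ : ℝ) * (42 / √A) = 42 * √(K * τ) := by rw [← e6]; ring
  have e8 : (K : ℝ) * (4 * √A) = 4 * √(K * τ) := by rw [← e5]; ring
  have e9 : (K : ℝ) * (11 * √A) = 11 * √(K * τ) := by rw [← e5]; ring
  rw [e7] at e4
  rw [e9] at e3
  -- The constant is `58 = 1 + 4 + 11 + 42`: the level `1 / √A`, the bonuses, the overshoots and the
  -- undershoots.
  rw [e8, mul_add, e6]
  linarith

/-- The increments of the total variation over the horizon `T`. -/
noncomputable def step (E : Environment K) (T t : ℕ) : ℝ :=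
  if t + 1 < T then ⨆ k, |mean E (t + 1) k - mean E t k| else 0

theorem step_nonneg (T t : ℕ) : 0 ≤ step E T t := by
  rw [step]
  split_ifs
  · exact Real.iSup_nonneg fun k => abs_nonneg _
  · exact le_rfl

theorem sum_step_le (T N : ℕ) : ∑ t ∈ Finset.range N, step E T t ≤ variation E T := by
  have h : variation E T = ∑ t ∈ Finset.range (T - 1), step E T t := by
    refine Finset.sum_congr rfl fun t ht => ?_
    rw [Finset.mem_range] at ht
    rw [step, if_pos (by omega)]
  rw [h]
  rw [← Finset.sum_filter_of_ne (f := step E T) (p := fun t => t + 1 < T) (s := Finset.range N)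
    fun t _ ht => by_contra fun hn => ht (if_neg hn)]
  refine Finset.sum_le_sum_of_subset_of_nonneg (fun t ht => ?_) fun t _ _ => step_nonneg _ _
  rw [Finset.mem_filter] at ht
  exact Finset.mem_range.2 (by omega)

theorem abs_mean_sub_le_sum_step {T s₀ : ℕ} (k : Fin K) (d : ℕ) (hT : s₀ + d < T) :
    |mean E (s₀ + d) k - mean E s₀ k| ≤ ∑ t ∈ Finset.range d, step E T (s₀ + t) := by
  induction d with
  | zero => simp
  | succ d ih =>
    rw [Finset.sum_range_succ]
    have h1 := ih (by omega)
    have h2 : |mean E (s₀ + d + 1) k - mean E (s₀ + d) k| ≤ step E T (s₀ + d) := by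
      rw [step, if_pos (by omega)]
      exact le_ciSup (f := fun k => |mean E (s₀ + d + 1) k - mean E (s₀ + d) k|)
        (Set.finite_range _).bddAbove k
    have h3 := abs_sub_le (mean E (s₀ + d + 1) k) (mean E (s₀ + d) k) (mean E s₀ k)
    rw [← add_assoc]
    linarith

/-- The regret of Resetting MOSS with restart period `τ`. -/
theorem regret_le {a b : ℝ} {T τ : ℕ} (hK : 0 < K) (hτ : 0 < τ) (hb : 0 ≤ b)
    (hE : IsSubGaussianEnv E a b T) (hρ : IsResettingMoss ρ τ) :
    regret E ρ T ≤ (T / τ + 1) * ((b + 58) * √(K * τ)) + 4 * τ * variation E T := by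
  rw [regret_eq_sum hE]
  set r : ℕ → ℝ := fun t => ∑ k, armProb E ρ t k * (bestMean E t - mean E t k)
  set B := (b + 58) * √(K * τ)
  have hB : 0 ≤ B := by positivity
  -- Induction over the epochs; the minimum with `T` takes care of a short last one.
  have key : ∀ i : ℕ, ∑ t ∈ Finset.range (min (τ * i) T), r t ≤
      i * B + 4 * τ * ∑ t ∈ Finset.range (τ * i), step E T t := by
    intro i
    induction i with
    | zero => simp
    | succ i ih =>
      have hsum : ∑ t ∈ Finset.range (τ * (i + 1)), step E T t =
          ∑ t ∈ Finset.range (τ * i), step E T t +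
            ∑ t ∈ Finset.range τ, step E T (τ * i + t) := by
        rw [mul_add, mul_one, Finset.sum_range_add]
      have hV0 : 0 ≤ ∑ t ∈ Finset.range τ, step E T (τ * i + t) :=
        Finset.sum_nonneg fun t _ => step_nonneg _ _
      rw [hsum]
      push_cast
      have hτ' : (0 : ℝ) ≤ τ := Nat.cast_nonneg _
      by_cases hi : T ≤ τ * i
      · rw [min_eq_right hi] at ih
        rw [min_eq_right (hi.trans (Nat.mul_le_mul_left _ i.le_succ))]
        nlinarith
      · obtain ⟨d, hd⟩ : ∃ d, min (τ * (i + 1)) T = τ * i + d :=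
          Nat.exists_eq_add_of_le (le_min (Nat.mul_le_mul_left _ i.le_succ) (by omega))
        rw [min_eq_left (by omega)] at ih
        have hdτ : d ≤ τ := by
          have := min_le_left (τ * (i + 1)) T
          rw [hd, mul_add, mul_one] at this
          omega
        have hdT : τ * i + d ≤ T := hd ▸ min_le_right _ _
        have hep := epoch_regret_le (i := i) hK hτ hb hE hρ hV0 (fun t h1 h2 h3 k => by
          obtain ⟨u, rfl⟩ := Nat.exists_eq_add_of_le h1
          refine (abs_mean_sub_le_sum_step k u h3).trans ?_
          exact Finset.sum_le_sum_of_subset_of_nonneg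
            (Finset.range_subset_range.2 (by omega)) fun t _ _ => step_nonneg _ _) d hdτ hdT
        rw [hd, ← Finset.sum_range_add_sum_Ico _ (Nat.le_add_right (τ * i) d)]
        linarith
  have h1 := key (T / τ + 1)
  have hlt : T < τ * (T / τ + 1) := by
    rw [mul_comm]; exact Nat.lt_mul_of_div_lt (Nat.lt_succ_self _) hτ
  rw [min_eq_right hlt.le] at h1
  refine h1.trans ?_
  have h2 : ((T / τ + 1 : ℕ) : ℝ) ≤ T / τ + 1 := by
    push_cast
    linarith [Nat.cast_div_le (α := ℝ) (m := T) (n := τ)]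
  have h3 := sum_step_le (E := E) T (τ * (T / τ + 1))
  gcongr

end UpperBound

/-! ### The balance between exploration and drift -/

section Rate

/-- The unrounded restart period. -/
noncomputable def idealPeriod (K T : ℕ) (V : ℝ) : ℝ :=
  (K : ℝ) ^ (1 / 3 : ℝ) * ((T : ℝ) / V) ^ (2 / 3 : ℝ)

/-- The optimal order of the regret. -/
noncomputable def rate (K T : ℕ) (V : ℝ) : ℝ :=
  ((K : ℝ) * V) ^ (1 / 3 : ℝ) * (T : ℝ) ^ (2 / 3 : ℝ)

variable {K T : ℕ} {V : ℝ}

theorem idealPeriod_pos (hK : 0 < K) (hT : 0 < T) (hV : 0 < V) : 0 < idealPeriod K T V := by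
  have : (0 : ℝ) < K := by exact_mod_cast hK
  have : (0 : ℝ) < T := by exact_mod_cast hT
  unfold idealPeriod
  positivity

theorem idealPeriod_mul (hT : 0 < T) (hV : 0 < V) : idealPeriod K T V * V = rate K T V := by
  have hT0 : (0 : ℝ) < T := by exact_mod_cast hT
  have hK0 : (0 : ℝ) ≤ K := Nat.cast_nonneg _
  rw [idealPeriod, rate, Real.mul_rpow hK0 hV.le, Real.div_rpow hT0.le hV.le]
  have h : V ^ (1 / 3 : ℝ) * V ^ (2 / 3 : ℝ) = V := by
    rw [← Real.rpow_add hV]; norm_num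
  have h2 : 0 < V ^ (2 / 3 : ℝ) := by positivity
  field_simp
  linear_combination (-(K : ℝ) ^ (1 / 3 : ℝ)) * h

/-- Together with `idealPeriod_mul` this says that exploration and drift cost the same at this
period. Both identities amount to `rate ^ 3 = K V T²`. -/
theorem mul_sqrt_div_idealPeriod (hK : 0 < K) (hT : 0 < T) (hV : 0 < V) :
    T * √(K / idealPeriod K T V) = rate K T V := by
  have hT0 : (0 : ℝ) < T := by exact_mod_cast hT
  have hK0 : (0 : ℝ) < K := by exact_mod_cast hK
  have hx := idealPeriod_pos hK hT hV
  have hr : 0 < rate K T V := by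
    rw [← idealPeriod_mul hT hV]; positivity
  have hcube : rate K T V ^ 3 = K * V * T ^ 2 := by
    rw [rate, mul_pow, ← Real.rpow_natCast, ← Real.rpow_natCast ((T : ℝ) ^ (2 / 3 : ℝ)),
      ← Real.rpow_mul (by positivity), ← Real.rpow_mul (by positivity)]
    norm_num
  have hxr : idealPeriod K T V = rate K T V / V := by
    rw [← idealPeriod_mul hT hV]; field_simp
  have hsq : (K : ℝ) / idealPeriod K T V = (rate K T V / T) ^ 2 := by
    rw [hxr]
    field_simp
    linear_combination -hcube
  rw [hsq, Real.sqrt_sq (by positivity)]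
  field_simp

end Rate

/-! ### The upper bound at the prescribed restart period -/

section UpperRate

variable {K : ℕ} {E : Environment K} {ρ : Policy K}

theorem regret_le_mul {a b : ℝ} {T : ℕ} (hE : IsSubGaussianEnv E a b T) :
    regret E ρ T ≤ b * T := by
  rw [regret_eq_sum hE]
  calc _ ≤ ∑ t ∈ Finset.range T, b := by
        refine Finset.sum_le_sum fun t ht => ?_
        calc _ ≤ ∑ k, armProb E ρ t k * b := by
              gcongr with k _
              · exact armProb_nonneg t k
              · exact hE.gap_le (Finset.mem_range.1 ht) k
          _ = b := by rw [← Finset.sum_mul, sum_armProb, one_mul]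
    _ = b * T := by rw [Finset.sum_const, Finset.card_range, nsmul_eq_mul, mul_comm]

theorem regret_le_rate {a b V : ℝ} {T : ℕ} (hK : 0 < K) (hT : 0 < T) (hV : 0 < V) (hb : 0 < b)
    (hτT : restartPeriod K T V ≤ T) (hρ : IsResettingMoss ρ (restartPeriod K T V))
    (hE : E ∈ envClass K a b V T) :
    regret E ρ T ≤ (2 * b + 124) * rate K T V := by
  have hT0 : (0 : ℝ) < T := by exact_mod_cast hT
  have hK0 : (0 : ℝ) < K := by exact_mod_cast hK
  have hx := idealPeriod_pos hK hT hV
  have hm := mul_sqrt_div_idealPeriod hK hT hV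
  have hV' := idealPeriod_mul (K := K) hT hV
  have hτdef : restartPeriod K T V = ⌈idealPeriod K T V⌉₊ := rfl
  set x := idealPeriod K T V
  have hr : 0 < rate K T V := by rw [← hV']; positivity
  -- Below `1` the rounded period need not be comparable to `x`, but then the rate is at least `T`
  -- and the trivial bound `b T` suffices.
  rcases lt_or_ge x 1 with hx1 | hx1
  · refine (regret_le_mul hE.1).trans ?_
    have h1 : 1 ≤ √((K : ℝ) / x) := by
      rw [Real.one_le_sqrt, one_le_div hx]
      have : (1 : ℝ) ≤ K := by exact_mod_cast hK
      linarith
    have h2 : (T : ℝ) ≤ rate K T V := by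
      rw [← hm]; exact le_mul_of_one_le_right hT0.le h1
    nlinarith [mul_le_mul_of_nonneg_left h2 hb.le, mul_pos hb hr]
  · set τ := restartPeriod K T V
    have hτx : x ≤ τ := by rw [hτdef]; exact Nat.le_ceil _
    have hτx2 : (τ : ℝ) ≤ 2 * x := by
      rw [hτdef]; linarith [Nat.ceil_lt_add_one hx.le]
    have hτ0 : (0 : ℝ) < τ := hx.trans_le hτx
    have hτ : 0 < τ := by exact_mod_cast hτ0
    refine (regret_le hK hτ hb.le hE.1 hρ).trans ?_
    have h1 : 4 * (τ : ℝ) * variation E T ≤ 8 * rate K T V := by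
      calc 4 * (τ : ℝ) * variation E T ≤ 4 * τ * V := by gcongr; exact hE.2
        _ ≤ 4 * (2 * x) * V := by gcongr
        _ = 8 * rate K T V := by rw [← hV']; ring
    have h2 : ((T : ℝ) / τ + 1) * √(K * τ) ≤ 2 * rate K T V := by
      -- The assumption that the period does not exceed the horizon absorbs the incomplete epoch.
      have h3 : (T : ℝ) / τ + 1 ≤ 2 * (T / τ) := by
        have : (1 : ℝ) ≤ T / τ := (one_le_div hτ0).2 (by exact_mod_cast hτT)
        linarith
      have h4 : 1 / (τ : ℝ) * √(K * τ) = √(K / τ) := by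
        rw [← Real.sqrt_sq (show (0 : ℝ) ≤ 1 / τ by positivity), ← Real.sqrt_mul (by positivity)]
        congr 1
        field_simp
      calc ((T : ℝ) / τ + 1) * √(K * τ) ≤ 2 * (T / τ) * √(K * τ) := by gcongr
        _ = 2 * (T * √(K / τ)) := by rw [← h4]; ring
        _ ≤ 2 * (T * √(K / x)) := by gcongr
        _ = 2 * rate K T V := by rw [hm]
    have h5 : ((T : ℝ) / τ + 1) * ((b + 58) * √(K * τ)) ≤ (b + 58) * (2 * rate K T V) := by
      calc _ = (b + 58) * (((T : ℝ) / τ + 1) * √(K * τ)) := by ring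
        _ ≤ _ := by gcongr
    linarith

end UpperRate

/-! ### Change of measure -/

section ChangeOfMeasure

variable {K : ℕ} {E E' : Environment K} {ρ : Policy K}

/-- If the rewards of `E'` have densities `exp (F t)` with respect to those of `E`, then the
histories have density `exp (cumul F)`. -/
theorem lintegral_historyLaw_of_density {F : ℕ → Fin K × ℝ → ℝ} (hF : ∀ t, Measurable (F t))
    {n : ℕ} (hE : ∀ t < n, ∀ k, ∀ f : ℝ → ℝ≥0∞, Measurable f →
      ∫⁻ x, f x ∂(E' t k : Measure ℝ) =
        ∫⁻ x, f x * ENNReal.ofReal (Real.exp (F t (k, x))) ∂(E t k : Measure ℝ))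
    {f : History K n → ℝ≥0∞} (hf : Measurable f) :
    ∫⁻ h, f h ∂(historyLaw E' ρ n) =
      ∫⁻ h, f h * ENNReal.ofReal (Real.exp (cumul F h)) ∂(historyLaw E ρ n) := by
  induction n with
  | zero => simp [historyLaw]
  | succ n ih =>
    have hfe : Measurable fun p : History K n × (Fin K × ℝ) => f (extend p) :=
      hf.comp measurable_extend
    have hm : Measurable fun h : History K n => ∫⁻ o, f (extend (h, o)) ∂(stepKernel E' ρ n h) :=
      hfe.lintegral_kernel_prod_right'
    have hFm : ∀ m, Measurable fun h : History K m => ENNReal.ofReal (Real.exp (cumul F h)) :=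
      fun m => (measurable_cumul hF m).exp.ennreal_ofReal
    rw [lintegral_historyLaw_succ hf, lintegral_historyLaw_succ
      (f := fun h => f h * ENNReal.ofReal (Real.exp (cumul F h))) (hf.mul (hFm (n + 1))),
      ih (fun t ht => hE t (ht.trans n.lt_succ_self)) hm]
    refine lintegral_congr fun h => ?_
    have hfh : Measurable fun o => f (extend (h, o)) := hfe.comp measurable_prodMk_left
    have hFn : Measurable fun o => ENNReal.ofReal (Real.exp (F n o)) :=
      (hF n).exp.ennreal_ofReal
    rw [lintegral_stepKernel h hfh]
    have hk : ∀ k, ∫⁻ x, f (extend (h, (k, x))) ∂(E' n k : Measure ℝ) =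
        ∫⁻ x, f (extend (h, (k, x))) * ENNReal.ofReal (Real.exp (F n (k, x)))
          ∂(E n k : Measure ℝ) := fun k =>
      hE n n.lt_succ_self k _ (hfh.comp measurable_prodMk_left)
    simp only [hk]
    rw [← lintegral_stepKernel (E := E) (ρ := ρ) h
      (f := fun o => f (extend (h, o)) * ENNReal.ofReal (Real.exp (F n o))) (hfh.mul hFn),
      ← lintegral_mul_const (f := fun o => f (extend (h, o)) * ENNReal.ofReal (Real.exp (F n o)))
        _ (hfh.mul hFn)]
    refine lintegral_congr fun o => ?_
    rw [cumul_extend, Real.exp_add, ENNReal.ofReal_mul (Real.exp_nonneg _)]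
    ring

/-- A pointwise substitute for Pinsker's inequality. With `w = exp (D / 2)`, the difference is at
most `|w - 1| (w + 1) ≤ 8 (w - 1)² + (w + 1)² / 32`; moreover `(w - 1)² ≤ exp D - 1 - D` and `(w +
1)² ≤ 2 (exp D + 1)`. When `exp D` is a density, the correction integrates to eight times the
relative entropy plus `1 / 8`. -/
theorem exp_mul_le_add (D : ℝ) {f : ℝ} (h0 : 0 ≤ f) (h1 : f ≤ 1) :
    Real.exp D * f ≤ f + (8 * (Real.exp D - 1 - D) + (Real.exp D + 1) / 16) := by
  have hw : Real.exp D = Real.exp (D / 2) ^ 2 := by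
    rw [← Real.exp_nat_mul]
    congr 1
    push_cast
    ring
  have hl := Real.add_one_le_exp (D / 2)
  have hp := Real.exp_pos (D / 2)
  rw [hw]
  set w := Real.exp (D / 2)
  have h2 : (w ^ 2 - 1) * f ≤ |w - 1| * (w + 1) := by
    calc (w ^ 2 - 1) * f ≤ |w ^ 2 - 1| * 1 := by gcongr; exact le_abs_self _
      _ = |w - 1| * (w + 1) := by
        rw [mul_one, show w ^ 2 - 1 = (w - 1) * (w + 1) by ring, abs_mul,
          abs_of_pos (show 0 < w + 1 by linarith)]
  have h3 : |w - 1| ^ 2 = (w - 1) ^ 2 := sq_abs _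
  nlinarith [sq_nonneg (16 * |w - 1| - (w + 1)), sq_nonneg (w - 1)]

/-- Comparison of expectations under two environments through their relative entropy. -/
theorem integral_le_of_density {F : ℕ → Fin K × ℝ → ℝ} (hF : ∀ t, Measurable (F t))
    {n : ℕ} (hE : ∀ t < n, ∀ k, ∀ f : ℝ → ℝ≥0∞, Measurable f →
      ∫⁻ x, f x ∂(E' t k : Measure ℝ) =
        ∫⁻ x, f x * ENNReal.ofReal (Real.exp (F t (k, x))) ∂(E t k : Measure ℝ))
    (hi : Integrable (fun h : History K n => cumul F h) (historyLaw E ρ n))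
    {f : History K n → ℝ} (hf : Measurable f) (h0 : ∀ h, 0 ≤ f h) (h1 : ∀ h, f h ≤ 1) :
    ∫ h, f h ∂(historyLaw E' ρ n) ≤
      ∫ h, f h ∂(historyLaw E ρ n) - 8 * ∫ h, cumul F h ∂(historyLaw E ρ n) + 1 / 8 := by
  have hFm : Measurable fun h : History K n => Real.exp (cumul F h) := (measurable_cumul hF n).exp
  have hone : ∫⁻ h : History K n,
      ENNReal.ofReal (Real.exp (cumul F h)) ∂(historyLaw E ρ n) = 1 := by
    have := lintegral_historyLaw_of_density (ρ := ρ) hF hE (f := fun _ => 1) measurable_const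
    simpa using this.symm
  have hM : Integrable (fun h : History K n => Real.exp (cumul F h)) (historyLaw E ρ n) := by
    refine ⟨hFm.aestronglyMeasurable, ?_⟩
    rw [hasFiniteIntegral_iff_ofReal (ae_of_all _ fun h => Real.exp_nonneg _), hone]
    exact ENNReal.one_lt_top
  have hM1 : ∫ h : History K n, Real.exp (cumul F h) ∂(historyLaw E ρ n) = 1 := by
    rw [integral_eq_lintegral_of_nonneg_ae (ae_of_all _ fun h => Real.exp_nonneg _)
      hFm.aestronglyMeasurable, hone, ENNReal.toReal_one]
  have hfi : Integrable f (historyLaw E ρ n) :=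
    Integrable.of_bound hf.aestronglyMeasurable 1 (ae_of_all _ fun h => by
      rw [Real.norm_eq_abs, abs_of_nonneg (h0 h)]; exact h1 h)
  have hMf : Integrable (fun h => Real.exp (cumul F h) * f h) (historyLaw E ρ n) := by
    refine hM.mono' (hFm.mul hf).aestronglyMeasurable (ae_of_all _ fun h => ?_)
    rw [Real.norm_eq_abs, abs_of_nonneg (mul_nonneg (Real.exp_nonneg _) (h0 h))]
    exact mul_le_of_le_one_right (Real.exp_nonneg _) (h1 h)
  have heq : ∫ h, f h ∂(historyLaw E' ρ n) =
      ∫ h, Real.exp (cumul F h) * f h ∂(historyLaw E ρ n) := by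
    rw [integral_eq_lintegral_of_nonneg_ae (ae_of_all _ h0) hf.aestronglyMeasurable,
      integral_eq_lintegral_of_nonneg_ae
        (ae_of_all _ fun h => mul_nonneg (Real.exp_nonneg _) (h0 h))
        (hFm.mul hf).aestronglyMeasurable,
      lintegral_historyLaw_of_density hF hE hf.ennreal_ofReal]
    congr 1
    refine lintegral_congr fun h => ?_
    rw [ENNReal.ofReal_mul (Real.exp_nonneg _), mul_comm]
  have i1 : Integrable (fun h : History K n => 8 * (Real.exp (cumul F h) - 1 - cumul F h))
      (historyLaw E ρ n) := ((hM.sub (integrable_const 1)).sub hi).const_mul 8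
  have i2 : Integrable (fun h : History K n => (Real.exp (cumul F h) + 1) / 16)
      (historyLaw E ρ n) := (hM.add (integrable_const 1)).div_const 16
  have i3 : Integrable (fun h : History K n => 8 * (Real.exp (cumul F h) - 1 - cumul F h) +
      (Real.exp (cumul F h) + 1) / 16) (historyLaw E ρ n) := i1.add i2
  have i4 : Integrable (fun h : History K n => Real.exp (cumul F h) - 1) (historyLaw E ρ n) :=
    hM.sub (integrable_const 1)
  have hle := integral_mono hMf (hfi.add i3) fun h => exp_mul_le_add (cumul F h) (h0 h) (h1 h)
  simp only [Pi.add_apply] at hle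
  rw [integral_add hfi i3, integral_add i1 i2, integral_const_mul, integral_sub i4 hi,
    integral_sub hM (integrable_const _), integral_div, integral_add hM (integrable_const _), hM1]
    at hle
  simp only [integral_const, probReal_univ, one_smul] at hle
  rw [heq]
  linarith

theorem integral_countFrom (s₀ n : ℕ) (k : Fin K) :
    ∫ h : History K n, (countFrom s₀ k h : ℝ) ∂(historyLaw E ρ n) =
      ∑ t ∈ Finset.Ico s₀ n, armProb E ρ t k := by
  obtain ⟨F, hF⟩ : ∃ F : ℕ → Fin K × ℝ → ℝ, F = fun t o => if s₀ ≤ t ∧ o.1 = k then 1 else 0 :=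
    ⟨_, rfl⟩
  have e : ∀ h : History K n, (countFrom s₀ k h : ℝ) = cumul F h := fun h => by
    simp [countFrom, cumul, hF]
  simp only [e]
  rw [(integrable_cumul (E := E) (ρ := ρ) (F := F) (n := n) ?_ ?_).2]
  · have : Finset.Ico s₀ n = (Finset.range n).filter (s₀ ≤ ·) := by
      ext t; simp [and_comm]
    rw [this, Finset.sum_filter]
    refine Finset.sum_congr rfl fun t _ => ?_
    by_cases ht : s₀ ≤ t <;> simp [ht, hF]
  · subst hF
    intro t
    refine Measurable.ite ?_ measurable_const measurable_const
    exact (MeasurableSet.const _).inter (measurable_fst (measurableSet_singleton k))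
  · subst hF
    intro t _ j
    exact integrable_const (if s₀ ≤ t ∧ j = k then (1 : ℝ) else 0)

theorem measurable_countFrom (s₀ n : ℕ) (k : Fin K) :
    Measurable fun h : History K n => (countFrom s₀ k h : ℝ) := by
  refine (measurable_from_top (f := fun m : ℕ => (m : ℝ))).comp ?_
  refine Finset.measurable_sum _ fun s _ => ?_
  refine Measurable.ite ?_ measurable_const measurable_const
  exact (MeasurableSet.const _).inter
    ((measurable_fst.comp (measurable_pi_apply s)) (measurableSet_singleton k))

end ChangeOfMeasure

/-! ### The lower bound -/

section LowerBound

variable {K : ℕ} {ρ : Policy K}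

/-- The parameter `1 / 2 + ε` of a two-point law. -/
noncomputable def biased (ε : ℝ) : unitInterval := Set.projIcc 0 1 zero_le_one (1 / 2 + ε)

theorem coe_biased {ε : ℝ} (h0 : 0 ≤ ε) (h1 : ε ≤ 1 / 2) : (biased ε : ℝ) = 1 / 2 + ε := by
  rw [biased, Set.projIcc_of_mem _ ⟨by linarith, by linarith⟩]

/-- The environment with rewards `a - 1 / 2` and `a + 1 / 2` in which the arm `σ t`, if any, has
mean `a + ε` in slot `t` and all others have mean `a`. -/
noncomputable def hardEnv (a ε : ℝ) (σ : ℕ → Option (Fin K)) : Environment K := fun t k =>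
  ⟨bernoulliMeasure (a + 1 / 2) (a - 1 / 2) (biased (if σ t = some k then ε else 0)),
    inferInstance⟩

theorem coe_hardEnv (a ε : ℝ) (σ : ℕ → Option (Fin K)) (t : ℕ) (k : Fin K) :
    (hardEnv a ε σ t k : Measure ℝ) =
      bernoulliMeasure (a + 1 / 2) (a - 1 / 2) (biased (if σ t = some k then ε else 0)) := rfl

theorem hardEnv_congr {a ε : ℝ} {σ σ' : ℕ → Option (Fin K)} {t : ℕ} (h : σ t = σ' t) :
    hardEnv a ε σ t = hardEnv a ε σ' t := by
  funext k
  refine Subtype.ext ?_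
  change (hardEnv a ε σ t k : Measure ℝ) = hardEnv a ε σ' t k
  simp only [coe_hardEnv, h]

theorem mean_hardEnv {a ε : ℝ} (h0 : 0 ≤ ε) (h1 : ε ≤ 1 / 2) (σ : ℕ → Option (Fin K)) (t : ℕ)
    (k : Fin K) : mean (hardEnv a ε σ) t k = a + if σ t = some k then ε else 0 := by
  rw [mean, coe_hardEnv, integral_bernoulliMeasure]
  split_ifs
  · rw [coe_biased h0 h1]; simp only [smul_eq_mul]; ring
  · rw [coe_biased le_rfl (by norm_num)]; simp only [smul_eq_mul]; ring

theorem isSubGaussianEnv_hardEnv {a b ε : ℝ} (h0 : 0 ≤ ε) (h1 : ε ≤ 1 / 2) (hb : ε ≤ b)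
    (σ : ℕ → Option (Fin K)) (T : ℕ) : IsSubGaussianEnv (hardEnv a ε σ) a b T := by
  intro t _ k
  refine ⟨?_, ?_⟩
  · have hmem : ∀ᵐ x ∂(hardEnv a ε σ t k : Measure ℝ), x ∈ Set.Icc (a - 1 / 2) (a + 1 / 2) := by
      have hs : MeasurableSet (Set.Icc (a - 1 / 2) (a + 1 / 2)) := measurableSet_Icc
      refine (mem_ae_iff_prob_eq_one hs).2 ?_
      rw [coe_hardEnv]
      exact bernoulliMeasure_apply_of_mem_of_mem _ hs ⟨by linarith, le_rfl⟩ ⟨le_rfl, by linarith⟩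
    have := hasSubgaussianMGF_of_mem_Icc (X := fun x : ℝ => x)
      (μ := (hardEnv a ε σ t k : Measure ℝ)) measurable_id.aemeasurable hmem
    have e : (‖a + 1 / 2 - (a - 1 / 2)‖₊ / 2) ^ 2 = (1 / 4 : NNReal) := by
      rw [show a + 1 / 2 - (a - 1 / 2) = 1 by ring]
      norm_num
    rwa [e] at this
  · rw [mean_hardEnv h0 h1]
    split_ifs
    · exact ⟨by linarith, by linarith⟩
    · exact ⟨by linarith, by linarith⟩

/-- The logarithm of the density of the rewards when the mean of arm `k` is raised by `ε` from
slot `s` on. -/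
noncomputable def logDensity (a ε : ℝ) (s : ℕ) (k : Fin K) (t : ℕ) (o : Fin K × ℝ) : ℝ :=
  if s ≤ t ∧ o.1 = k then
    if o.2 = a + 1 / 2 then Real.log (1 + 2 * ε) else Real.log (1 - 2 * ε)
  else 0

theorem measurable_logDensity (a ε : ℝ) (s : ℕ) (k : Fin K) (t : ℕ) :
    Measurable (logDensity a ε s k t) := by
  refine Measurable.ite ?_ (Measurable.ite ?_ measurable_const measurable_const) measurable_const
  · exact (MeasurableSet.const _).inter (measurable_fst (measurableSet_singleton k))
  · exact measurable_snd (measurableSet_singleton _)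

theorem lintegral_hardEnv {a ε : ℝ} (h0 : 0 ≤ ε) (h1 : ε ≤ 1 / 2) (σ : ℕ → Option (Fin K)) (t : ℕ)
    (k : Fin K) (f : ℝ → ℝ≥0∞) :
    ∫⁻ x, f x ∂(hardEnv a ε σ t k : Measure ℝ) =
      ENNReal.ofReal (1 / 2 + if σ t = some k then ε else 0) * f (a + 1 / 2) +
      ENNReal.ofReal (1 / 2 - if σ t = some k then ε else 0) * f (a - 1 / 2) := by
  have hq : ∀ p : unitInterval, ∫⁻ x, f x ∂(bernoulliMeasure (a + 1 / 2) (a - 1 / 2) p) =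
      ENNReal.ofReal p * f (a + 1 / 2) + ENNReal.ofReal (1 - p) * f (a - 1 / 2) := by
    intro p
    rw [bernoulliMeasure_def, lintegral_add_measure, lintegral_smul_measure,
      lintegral_smul_measure, lintegral_dirac, lintegral_dirac]
    congr 1
    · rw [ENNReal.smul_def, smul_eq_mul, ← ENNReal.ofReal_coe_nnreal]; rfl
    · rw [ENNReal.smul_def, smul_eq_mul, ← ENNReal.ofReal_coe_nnreal]; rfl
  rw [coe_hardEnv, hq]
  split_ifs
  · rw [coe_biased h0 h1]; congr 3; ring
  · rw [coe_biased le_rfl (by norm_num)]; congr 3; ring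

/-- The best arms `σ` before slot `s` and the arm `k`, if any, from slot `s` on. -/
def switchAt (σ : ℕ → Option (Fin K)) (s : ℕ) (k : Option (Fin K)) (t : ℕ) : Option (Fin K) :=
  if t < s then σ t else k

/-- Relative to the fair two-point law, raising the mean by `ε` multiplies the two masses by `1 + 2
ε` and `1 - 2 ε`. The two environments differ only for arm `k` from slot `s` on. -/
theorem lintegral_hardEnv_switchAt {a ε : ℝ} (h0 : 0 ≤ ε) (h1 : ε < 1 / 2)
    (σ : ℕ → Option (Fin K)) (s : ℕ) (k : Fin K) (t : ℕ) (j : Fin K) (f : ℝ → ℝ≥0∞) :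
    ∫⁻ x, f x ∂(hardEnv a ε (switchAt σ s (some k)) t j : Measure ℝ) =
      ∫⁻ x, f x * ENNReal.ofReal (Real.exp (logDensity a ε s k t (j, x)))
        ∂(hardEnv a ε (switchAt σ s none) t j : Measure ℝ) := by
  rw [lintegral_hardEnv h0 h1.le, lintegral_hardEnv h0 h1.le]
  by_cases ht : t < s
  · simp [switchAt, ht, logDensity, not_le.2 ht]
  · by_cases hj : j = k
    · subst hj
      have hne : a - 1 / 2 ≠ a + 1 / 2 := by linarith
      have hst : s ≤ t := not_lt.1 ht
      simp only [switchAt, ht, if_false, if_true, logDensity, hst, true_and, hne, reduceCtorEq,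
        add_zero, sub_zero]
      rw [Real.exp_log (by linarith), Real.exp_log (by linarith),
        show 1 / 2 + ε = 1 / 2 * (1 + 2 * ε) by ring, show 1 / 2 - ε = 1 / 2 * (1 - 2 * ε) by ring,
        ENNReal.ofReal_mul (by norm_num), ENNReal.ofReal_mul (by norm_num)]
      ring
    · have hj' : ¬ k = j := fun h => hj h.symm
      simp [switchAt, ht, logDensity, hj, hj']

/-- The integral is `log (1 - 4 ε²) / 2`, the negative of the relative entropy of one sample, and
`log (1 - u) ≥ -2 u` for `0 ≤ u ≤ 1 / 4`. -/
theorem integral_logDensity_ge {a ε : ℝ} (h0 : 0 ≤ ε) (h1 : ε ≤ 1 / 4)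
    (σ : ℕ → Option (Fin K)) {s t : ℕ} (hst : s ≤ t) (k : Fin K) :
    -(4 * ε ^ 2) ≤ ∫ x, logDensity a ε s k t (k, x)
      ∂(hardEnv a ε (switchAt σ s none) t k : Measure ℝ) := by
  have hne : a - 1 / 2 ≠ a + 1 / 2 := by linarith
  rw [coe_hardEnv, integral_bernoulliMeasure]
  simp only [switchAt, not_lt.2 hst, if_false, reduceCtorEq, logDensity, hst, true_and, if_true,
    hne, smul_eq_mul]
  rw [coe_biased le_rfl (by norm_num)]
  have hl : Real.log (1 + 2 * ε) + Real.log (1 - 2 * ε) = Real.log (1 - 4 * ε ^ 2) := by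
    rw [← Real.log_mul (by linarith) (by linarith)]
    ring_nf
  have hpos : 0 < 1 - 4 * ε ^ 2 := by nlinarith
  have h2 := Real.one_sub_inv_le_log_of_pos hpos
  have h3 : -(8 * ε ^ 2) ≤ 1 - (1 - 4 * ε ^ 2)⁻¹ := by
    have : (1 - 4 * ε ^ 2)⁻¹ ≤ 1 + 8 * ε ^ 2 := by
      rw [inv_le_iff_one_le_mul₀ hpos]
      have hε : ε ^ 2 ≤ 1 / 16 := by nlinarith
      nlinarith [mul_nonneg (sq_nonneg ε) (sub_nonneg.2 hε)]
    linarith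
  linarith

/-- The expected number of selections of arm `k` grows little when its mean is raised by `ε`. -/
theorem sum_armProb_switchAt_le {a ε : ℝ} (h0 : 0 ≤ ε) (h1 : ε ≤ 1 / 4)
    (σ : ℕ → Option (Fin K)) (s d : ℕ) (k : Fin K) :
    ∑ t ∈ Finset.Ico s (s + d), armProb (hardEnv a ε (switchAt σ s (some k))) ρ t k ≤
      (1 + 32 * ε ^ 2 * d) *
        ∑ t ∈ Finset.Ico s (s + d), armProb (hardEnv a ε (switchAt σ s none)) ρ t k + d / 8 := by
  rcases Nat.eq_zero_or_pos d with rfl | hd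
  · simp
  have hd0 : (0 : ℝ) < d := by exact_mod_cast hd
  set E₀ := hardEnv a ε (switchAt σ s none)
  set E₁ := hardEnv a ε (switchAt σ s (some k))
  obtain ⟨hi, heq⟩ := integrable_cumul (E := E₀) (ρ := ρ) (n := s + d)
    (measurable_logDensity a ε s k) fun t _ j => by
      refine Integrable.of_bound ((measurable_logDensity a ε s k t).comp
        measurable_prodMk_left).aestronglyMeasurable
        (|Real.log (1 + 2 * ε)| + |Real.log (1 - 2 * ε)|) (ae_of_all _ fun x => ?_)
      have p1 := abs_nonneg (Real.log (1 + 2 * ε))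
      have p2 := abs_nonneg (Real.log (1 - 2 * ε))
      simp only [logDensity, Real.norm_eq_abs]
      split_ifs
      · linarith
      · linarith
      · simp only [abs_zero]; linarith
  have hent : -(4 * ε ^ 2) * ∑ t ∈ Finset.Ico s (s + d), armProb E₀ ρ t k ≤
      ∫ h : History K (s + d), cumul (logDensity a ε s k) h ∂(historyLaw E₀ ρ (s + d)) := by
    have hI : Finset.Ico s (s + d) = (Finset.range (s + d)).filter (s ≤ ·) := by
      ext t; simp [and_comm]
    rw [heq, hI, Finset.sum_filter, Finset.mul_sum]
    refine Finset.sum_le_sum fun t _ => ?_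
    rw [Finset.sum_eq_single k (fun j _ hj => by simp [logDensity, hj]) (by simp)]
    split_ifs with hst
    · rw [mul_comm]
      exact mul_le_mul_of_nonneg_left (integral_logDensity_ge h0 h1 σ hst k) (armProb_nonneg t k)
    · simp [logDensity, hst]
  -- The test function is the fraction of the batch spent on arm `k`; the factor `32` is eight times
  -- the entropy `4 ε²` per selection.
  have hle := integral_le_of_density (E := E₀) (E' := E₁) (ρ := ρ) (n := s + d)
    (measurable_logDensity a ε s k)
    (fun t _ j f _ => lintegral_hardEnv_switchAt h0 (by linarith) σ s k t j f) hi
    (f := fun h => (countFrom s k h : ℝ) / d) ((measurable_countFrom s _ k).div_const _)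
    (fun h => by positivity) (fun h => by
      rw [div_le_one hd0]
      have := countFrom_le s (s + d) k h
      exact_mod_cast this.trans (by omega))
  rw [integral_div, integral_div, integral_countFrom, integral_countFrom] at hle
  set N₀ := ∑ t ∈ Finset.Ico s (s + d), armProb E₀ ρ t k
  set N₁ := ∑ t ∈ Finset.Ico s (s + d), armProb E₁ ρ t k
  have h3 : N₁ / d ≤ N₀ / d + 32 * ε ^ 2 * N₀ + 1 / 8 := by linarith
  have h4 := mul_le_mul_of_nonneg_right h3 hd0.le
  rw [div_mul_cancel₀ _ hd0.ne'] at h4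
  refine h4.trans_eq ?_
  field_simp

/-- In every batch some arm is hard to find. -/
theorem exists_hard_arm {a ε : ℝ} (hK : 2 ≤ K) (h0 : 0 ≤ ε) (h1 : ε ≤ 1 / 4)
    (σ : ℕ → Option (Fin K)) (s d : ℕ) (hd : 256 * ε ^ 2 * d ≤ K) :
    ∃ k, ∑ t ∈ Finset.Ico s (s + d), armProb (hardEnv a ε (switchAt σ s (some k))) ρ t k ≤
      3 / 4 * d := by
  by_contra! hcon
  have : Nonempty (Fin K) := ⟨⟨0, by omega⟩⟩
  have hlt := Finset.sum_lt_sum_of_nonempty Finset.univ_nonempty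
    fun k (_ : k ∈ Finset.univ) => hcon k
  have hle := Finset.sum_le_sum fun k (_ : k ∈ Finset.univ) =>
    sum_armProb_switchAt_le (ρ := ρ) (a := a) h0 h1 σ s d k
  have hsum : ∑ k, ∑ t ∈ Finset.Ico s (s + d),
      armProb (hardEnv a ε (switchAt σ s none)) ρ t k = d := by
    rw [Finset.sum_comm]
    simp [sum_armProb]
  rw [Finset.sum_add_distrib, ← Finset.mul_sum, hsum] at hle
  simp only [Finset.sum_const, nsmul_eq_mul, Finset.card_univ, Fintype.card_fin] at hle hlt
  have hK' : (2 : ℝ) ≤ K := by exact_mod_cast hK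
  have hd0 : (0 : ℝ) ≤ d := Nat.cast_nonneg d
  -- Summed over the arms, the bounds total at most `d + K d / 8 + K d / 8`, which for `K ≥ 2` is at
  -- most `3 K d / 4`.
  nlinarith [mul_le_mul_of_nonneg_right hd hd0, mul_le_mul_of_nonneg_right hK' hd0]

/-- A choice of the best arms, constant on batches of `L` slots, for which the policy rarely
selects the best arm. -/
theorem exists_hard_sequence {a ε : ℝ} (hK : 2 ≤ K) (h0 : 0 ≤ ε) (h1 : ε ≤ 1 / 4) {L : ℕ}
    (hL : 0 < L) (hLK : 256 * ε ^ 2 * L ≤ K) {d : ℕ → ℕ} (hd : ∀ j, d j ≤ L) (J : ℕ) :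
    ∃ σ : ℕ → Fin K, ∀ j < J, ∑ t ∈ Finset.Ico (L * j) (L * j + d j),
      armProb (hardEnv a ε fun t => some (σ (t / L))) ρ t (σ j) ≤ 3 / 4 * d j := by
  induction J with
  | zero => exact ⟨fun _ => ⟨0, by omega⟩, fun j hj => absurd hj (Nat.not_lt_zero j)⟩
  | succ J ih =>
    obtain ⟨σ, hσ⟩ := ih
    have hdJ : 256 * ε ^ 2 * d J ≤ K := by
      refine le_trans ?_ hLK
      have : (d J : ℝ) ≤ L := by exact_mod_cast hd J
      gcongr
    obtain ⟨k, hk⟩ := exists_hard_arm (ρ := ρ) (a := a) hK h0 h1 (fun t => some (σ (t / L)))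
      (L * J) (d J) hdJ
    have hdiv : ∀ {u j}, u < L * j + L → u / L ≤ j := fun {u j} hu => by
      have : u / L < j + 1 := Nat.div_lt_of_lt_mul (by rw [mul_add, mul_one]; exact hu)
      omega
    refine ⟨Function.update σ J k, fun j hj => ?_⟩
    rcases Nat.lt_succ_iff_lt_or_eq.1 hj with hlt | rfl
    -- Selections in earlier batches do not see the new arm.
    · refine le_trans (le_of_eq ?_) (hσ j hlt)
      refine Finset.sum_congr rfl fun t ht => ?_
      rw [Function.update_of_ne hlt.ne]
      refine armProb_congr (fun u hu => hardEnv_congr ?_) _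
      have htj := (Finset.mem_Ico.1 ht).2
      have : u / L ≤ j := hdiv (by have := hd j; omega)
      rw [Function.update_of_ne (by omega)]
    -- Up to the end of batch `J`, the updated sequence is the old one switched to `k` at slot `L *
    -- J`.
    · refine le_trans (le_of_eq ?_) hk
      refine Finset.sum_congr rfl fun t ht => ?_
      rw [Function.update_self]
      refine armProb_congr (fun u hu => hardEnv_congr ?_) _
      have htj := (Finset.mem_Ico.1 ht).2
      have huj : u / L ≤ j := hdiv (by have := hd j; omega)
      simp only [switchAt]
      split_ifs with hlt
      · have : u / L < j := Nat.div_lt_of_lt_mul hlt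
        rw [Function.update_of_ne this.ne]
      · have : u / L = j :=
          le_antisymm huj ((Nat.le_div_iff_mul_le hL).2 (by rw [mul_comm]; omega))
        rw [this, Function.update_self]

/-- The means can change only when `t / L` jumps, and then each moves by at most `ε`; the supremum
over the arms counts a change once. -/
theorem variation_hardEnv_le {a ε : ℝ} (h0 : 0 ≤ ε) (h1 : ε ≤ 1 / 2) (σ : ℕ → Fin K) (L T : ℕ) :
    variation (hardEnv a ε fun t => some (σ (t / L))) T ≤ ε * ((T - 1) / L : ℕ) := by
  rw [variation]
  induction T - 1 with
  | zero => simp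
  | succ n ih =>
    rw [Finset.sum_range_succ]
    have hstep : (⨆ k, |mean (hardEnv a ε fun t => some (σ (t / L))) (n + 1) k -
        mean (hardEnv a ε fun t => some (σ (t / L))) n k|) ≤
        ε * (((n + 1) / L : ℕ) - (n / L : ℕ)) := by
      have hmono : n / L ≤ (n + 1) / L := Nat.div_le_div_right n.le_succ
      have hcast : ((n / L : ℕ) : ℝ) ≤ ((n + 1) / L : ℕ) := by exact_mod_cast hmono
      refine Real.iSup_le (fun k => ?_) (mul_nonneg h0 (sub_nonneg.2 hcast))
      rw [mean_hardEnv h0 h1, mean_hardEnv h0 h1]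
      rcases hmono.eq_or_lt with heq | hlt
      · simp [heq]
      · have : (1 : ℝ) ≤ ((n + 1) / L : ℕ) - (n / L : ℕ) := by
          have : ((n / L + 1 : ℕ) : ℝ) ≤ ((n + 1) / L : ℕ) := by exact_mod_cast hlt
          push_cast at this ⊢
          linarith
        refine le_trans ?_ (le_mul_of_one_le_right h0 this)
        rw [abs_le]
        constructor <;> split_ifs <;> linarith
    rw [mul_sub] at hstep
    linarith

theorem regret_hardEnv {a ε : ℝ} (h0 : 0 ≤ ε) (h1 : ε ≤ 1 / 2) (σ : ℕ → Fin K) (T : ℕ) :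
    regret (hardEnv a ε fun t => some (σ t)) ρ T =
      ε * (T - ∑ t ∈ Finset.range T, armProb (hardEnv a ε fun t => some (σ t)) ρ t (σ t)) := by
  rw [regret_eq_sum (isSubGaussianEnv_hardEnv h0 h1 le_rfl _ T)]
  have hbest : ∀ t, bestMean (hardEnv a ε fun t => some (σ t)) t = a + ε := fun t => by
    have : Nonempty (Fin K) := ⟨σ t⟩
    refine le_antisymm (ciSup_le fun k => ?_) ?_
    · rw [mean_hardEnv h0 h1]
      split_ifs <;> linarith
    · refine le_trans (le_of_eq ?_) (mean_le_bestMean t (σ t))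
      rw [mean_hardEnv h0 h1, if_pos rfl]
  have hterm : ∀ t k, armProb (hardEnv a ε fun t => some (σ t)) ρ t k *
      (bestMean (hardEnv a ε fun t => some (σ t)) t -
        mean (hardEnv a ε fun t => some (σ t)) t k) =
      ε * (armProb (hardEnv a ε fun t => some (σ t)) ρ t k -
        if σ t = k then armProb (hardEnv a ε fun t => some (σ t)) ρ t k else 0) := fun t k => by
    rw [hbest, mean_hardEnv h0 h1]
    simp only [Option.some.injEq]
    split_ifs <;> ring
  simp only [hterm, ← Finset.mul_sum, Finset.sum_sub_distrib, sum_armProb, Finset.sum_ite_eq,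
    Finset.mem_univ, if_true, Finset.sum_const, Finset.card_range, nsmul_eq_mul, mul_one]

/-- A batch of length `L` with gap `ε` costs every policy a fraction of `ε * T`. -/
theorem exists_regret_ge {a ε : ℝ} (hK : 2 ≤ K) (h0 : 0 ≤ ε) (h1 : ε ≤ 1 / 4) {L : ℕ}
    (hL : 0 < L) (hLK : 256 * ε ^ 2 * L ≤ K) (T : ℕ) :
    ∃ σ : ℕ → Fin K, ε * T / 4 ≤ regret (hardEnv a ε fun t => some (σ (t / L))) ρ T := by
  -- Since `L ≥ 1`, `T` batches cover the horizon. Truncated subtraction shortens the last one and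
  -- makes those beyond the horizon empty.
  obtain ⟨σ, hσ⟩ := exists_hard_sequence (ρ := ρ) (a := a) hK h0 h1 hL hLK
    (d := fun j => min L (T - L * j)) (fun j => min_le_left _ _) T
  refine ⟨σ, ?_⟩
  rw [regret_hardEnv h0 (by linarith) (fun t => σ (t / L))]
  have key : ∀ i ≤ T, ∑ t ∈ Finset.range (min (L * i) T),
      armProb (hardEnv a ε fun t => some (σ (t / L))) ρ t (σ (t / L)) ≤
        3 / 4 * (min (L * i) T : ℕ) := by
    intro i
    induction i with
    | zero => simp
    | succ i ih =>
      intro hi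
      have hmin : min (L * (i + 1)) T = min (L * i) T + min L (T - L * i) := by
        rw [mul_add, mul_one]; omega
      rcases le_total T (L * i) with hTi | hTi
      · have e : min (L * (i + 1)) T = min (L * i) T := by omega
        rw [e]
        exact ih (by omega)
      · have e : min (L * i) T = L * i := min_eq_left hTi
        have ih' := ih (by omega)
        have hb := hσ i (by omega)
        rw [e] at hmin ih'
        rw [hmin, ← Finset.sum_range_add_sum_Ico _ (Nat.le_add_right (L * i) _)]
        have hcongr : ∑ t ∈ Finset.Ico (L * i) (L * i + min L (T - L * i)),
            armProb (hardEnv a ε fun t => some (σ (t / L))) ρ t (σ (t / L)) =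
            ∑ t ∈ Finset.Ico (L * i) (L * i + min L (T - L * i)),
            armProb (hardEnv a ε fun t => some (σ (t / L))) ρ t (σ i) := by
          refine Finset.sum_congr rfl fun t ht => ?_
          rw [Finset.mem_Ico] at ht
          have : t / L = i := by
            rw [Nat.div_eq_iff hL]
            have := min_le_left L (T - L * i)
            rw [mul_comm i L]
            constructor <;> omega
          rw [this]
        rw [hcongr]
        push_cast at hb ih' ⊢
        linarith
  have hT := key T le_rfl
  rw [min_eq_right (Nat.le_mul_of_pos_left T hL)] at hT
  nlinarith [mul_le_mul_of_nonneg_left hT h0]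

end LowerBound

/-! ### Choice of gap and batch length for the lower bound -/

theorem le_idealPeriod {K T : ℕ} {V : ℝ} (hK : 0 < K) (hV : 0 < V) (hVT : V ≤ (T : ℝ) / K) :
    (K : ℝ) ≤ idealPeriod K T V := by
  have hK0 : (0 : ℝ) < K := by exact_mod_cast hK
  have h1 : (K : ℝ) ≤ T / V := by
    rw [le_div_iff₀ hV, mul_comm]
    exact (le_div_iff₀ hK0).1 hVT
  calc (K : ℝ) = (K : ℝ) ^ (1 / 3 : ℝ) * (K : ℝ) ^ (2 / 3 : ℝ) := by
        rw [← Real.rpow_add hK0]; norm_num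
    _ ≤ idealPeriod K T V := by unfold idealPeriod; gcongr

theorem exists_regret_ge_rate {a b V : ℝ} {K T : ℕ} (hb : 0 < b) (hK : 2 ≤ K) (hT : 0 < T)
    (hV : 0 < V) (hVT : V ≤ (T : ℝ) / K) (ρ : Policy K) :
    ∃ E ∈ envClass K a b V T, min b (1 / 32) / 4 * rate K T V ≤ regret E ρ T := by
  have hT0 : (0 : ℝ) < T := by exact_mod_cast hT
  have hK2 : (2 : ℝ) ≤ K := by exact_mod_cast hK
  have hx := le_idealPeriod (by omega) hV hVT
  have hm := mul_sqrt_div_idealPeriod (K := K) (by omega) hT hV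
  have hxV := idealPeriod_mul (K := K) hT hV
  set x := idealPeriod K T V
  have hx0 : 0 < x := by linarith
  obtain ⟨c, hc⟩ : ∃ c, c = min b (1 / 32) := ⟨_, rfl⟩
  have hc0 : 0 < c := by rw [hc]; positivity
  have hcb : c ≤ b := hc ▸ min_le_left _ _
  have hc32 : c ≤ 1 / 32 := hc ▸ min_le_right _ _
  -- Since `K ≤ x`, the gap is at most `c`, hence at most `b` and `1 / 4`. With batches of at most
  -- `2 x` slots, the entropy condition becomes `512 c² ≤ 1`, which `c ≤ 1 / 32` ensures.
  obtain ⟨ε, hε⟩ : ∃ ε, ε = c * √(K / x) := ⟨_, rfl⟩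
  have hε0 : 0 ≤ ε := by rw [hε]; positivity
  have hεc : ε ≤ c := by
    rw [hε]
    refine mul_le_of_le_one_right hc0.le (Real.sqrt_le_one.2 ?_)
    exact (div_le_one hx0).2 hx
  have hceil : (⌈x⌉₊ : ℝ) ≤ 2 * x := by linarith [Nat.ceil_lt_add_one hx0.le]
  have hceil0 : 0 < ⌈x⌉₊ := Nat.ceil_pos.2 hx0
  obtain ⟨L, hL⟩ : ∃ L, L = min ⌈x⌉₊ T := ⟨_, rfl⟩
  have hL0 : 0 < L := hL ▸ lt_min hceil0 hT
  have hLx : (L : ℝ) ≤ 2 * x := by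
    refine le_trans ?_ hceil
    exact_mod_cast hL ▸ min_le_left _ _
  have hLK : 256 * ε ^ 2 * L ≤ K := by
    have e : ε ^ 2 = c ^ 2 * (K / x) := by
      rw [hε, mul_pow, Real.sq_sqrt (by positivity)]
    calc 256 * ε ^ 2 * L ≤ 256 * (c ^ 2 * (K / x)) * (2 * x) := by rw [e]; gcongr
      _ = 512 * c ^ 2 * K := by field_simp; ring
      _ ≤ 1 * K := by gcongr; nlinarith
      _ = K := one_mul _
  obtain ⟨σ, hσ⟩ := exists_regret_ge (ρ := ρ) (a := a) hK hε0 (by linarith) hL0 hLK T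
  refine ⟨_, ⟨isSubGaussianEnv_hardEnv hε0 (by linarith) (hεc.trans hcb) _ T, ?_⟩, le_trans ?_ hσ⟩
  · refine (variation_hardEnv_le hε0 (by linarith) σ L T).trans ?_
    -- Either the batches have length at least `x` and the variation is at most `ε T / x = c V`, or
    -- a single batch fills the horizon and the means never change.
    rcases le_total ⌈x⌉₊ T with h | h
    · rw [min_eq_left h] at hL
      have h1 : (((T - 1) / L : ℕ) : ℝ) ≤ T / x := by
        have hxL : x ≤ L := by rw [hL]; exact Nat.le_ceil x
        calc (((T - 1) / L : ℕ) : ℝ) ≤ ((T - 1 : ℕ) : ℝ) / L := Nat.cast_div_le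
          _ ≤ T / L := by gcongr; omega
          _ ≤ T / x := by gcongr
      calc ε * ((T - 1) / L : ℕ) ≤ ε * (T / x) := by gcongr
        _ = c * (T * √(K / x)) / x := by rw [hε]; ring
        _ = c * V := by rw [hm, ← hxV]; field_simp
        _ ≤ 1 * V := by gcongr; linarith
        _ = V := one_mul _
    · rw [min_eq_right h] at hL
      rw [hL, Nat.div_eq_of_lt (by omega)]
      simpa using hV.le
  · rw [← hc, ← hm, hε]
    exact le_of_eq (by ring)

end Bandit

theorem theorem1 (b : ℝ) (hb : 0 < b) :
    (∃ C : ℝ, 0 < C ∧ ∀ (a : ℝ) (K T : ℕ) (V : ℝ), 0 < K → 0 < T → 0 < V →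
      Bandit.restartPeriod K T V ≤ T →
      ∀ ρ : Bandit.Policy K, Bandit.IsResettingMoss ρ (Bandit.restartPeriod K T V) →
        Bandit.worstCaseRegret ρ a b V T ≤
          ((C * ((K : ℝ) * V) ^ (1 / 3 : ℝ) * (T : ℝ) ^ (2 / 3 : ℝ) : ℝ) : EReal)) ∧
    (∃ c : ℝ, 0 < c ∧ ∀ (a : ℝ) (K T : ℕ) (V : ℝ), 2 ≤ K → 0 < T →
      1 / (K : ℝ) ≤ V → V ≤ (T : ℝ) / K →
        ((c * ((K : ℝ) * V) ^ (1 / 3 : ℝ) * (T : ℝ) ^ (2 / 3 : ℝ) : ℝ) : EReal) ≤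
          Bandit.minimaxRegret K a b V T) := by
  -- The first constant is `2 (b + 58) + 8`, from exploration and drift; the second is `c / 4`, from
  -- regret `ε T / 4` with `ε = c √(K / x)`.
  refine ⟨⟨2 * b + 124, by positivity, ?_⟩, ⟨min b (1 / 32) / 4, by positivity, ?_⟩⟩
  · intro a K T V hK hT hV hτ ρ hρ
    refine iSup₂_le fun E hE => EReal.coe_le_coe_iff.2 ?_
    rw [mul_assoc]
    exact Bandit.regret_le_rate hK hT hV hb hτ hρ hE
  · intro a K T V hK hT hV1 hV2
    have hK0 : (0 : ℝ) < K := by exact_mod_cast (by omega : 0 < K)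
    refine le_iInf fun ρ => ?_
    obtain ⟨E, hE, hr⟩ := Bandit.exists_regret_ge_rate (a := a) hb hK hT
      ((by positivity : (0 : ℝ) < 1 / K).trans_le hV1) hV2 ρ
    refine le_trans (EReal.coe_le_coe_iff.2 ?_) (le_iSup₂ (f := fun E
      (_ : E ∈ Bandit.envClass K a b V T) => ((Bandit.regret E ρ T : ℝ) : EReal)) E hE)
    rw [mul_assoc]
    exact hr
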